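/- **Setting.** Let $G$ be a finite directed acyclic (multi)graph with source $s$, sink $t\ne s$, finite capacities $c_e\ge 0$ and edge costs $q_e>0$; let $Q>0$ be a reward per unit of flow. An $s$–$t$ flow is a vector $x$ with $0\le x_e\le c_e$ that is conserved at every vertex other than $s,t$; its value $f$ is the net amount of flow leaving $s$. The min-cost flow problem is to minimize $\sum_e q_ex_e-Qf$ over all $s$–$t$ flows. Let $0<w_{\min}\le q_e,\,Q\le w_{\max}$, where $w_{\max}/w_{\min}=2^T$ is a power of $2$. **Algorithm.** $\textsc{ScalingFlow}$ takes an acyclic network with source $s$, sink $t$, edge weights $w_e$ with $w_{\min}\le|w_e|\le w_{\max}$ and an error tolerance $\eta$. Let $l_u$ be the length of a longest path from $s$ to $u$ ($0$ if there is none), $D=l_t$, and $\delta_i=\eta w_{\max}/2^i$. It starts with $x=0$ and potentials $p_u=w_{\max}l_u$. For $e=uv$ let $w_e^p=w_e+p_u-p_v$. In scale $i$, the eligible graph consists of the forward arcs $u\to v$ with $w^p_e\ge\delta_i$ and $x_e<c_e$, of capacity $c_e-x_e$, and the backward arcs $v\to u$ with $w_e^p\le 0$ and $x_e>0$, of capacity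 $x_e$. For $i=0,1,\dots,T$: 1. until $p_t=Dw_{\max}/2^{i+1}$ (if $i<T$) or $p_t=0$ (if $i=T$), repeat: send an arbitrary blocking flow (an $s$–$t$ flow of non-negative value such that every $s$–$t$ path has a saturated arc) in the eligible graph; recompute the eligible graph, and set $p_u\leftarrow p_u-\delta_i$ for every vertex $u$ that is not reachable from $s$ in it; 2. if $i<T$, set $p_u\leftarrow p_u+\delta_il_u$ for all $u$. The flow $x$ at the end is returned. For min-cost flow, $\textsc{ScalingFlow}$ is run on the network obtained from $G$ by giving each edge $e$ the weight $-q_e$ and adding an edge of weight $Q$ and infinite capacity from $t$ to a new vertex $t'$, which becomes the sink. The flow on the new edge is returned as $f$, and the flow on the edges of $G$ as $x$. **Lemma.** Let $\varepsilon$ be a real number and let the error tolerance $\eta$ be a power of $2$ with $\eta<1/10$ and $\eta\le\varepsilon/8$. Then, whichever blocking flows are chosen, $\textsc{ScalingFlow}$ halts on this instance after finitely many steps. It returns an $s$–$t$ flow $x$ of $G$, together with its value $f$, such that for every optimal solution $x^*$ of the min-cost flow problem, of value $f^*$, $$\sum_e q_ex_e-Qf\;\le\;(1+\varepsilon)\Big(\sum_e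 q_ex^*_e-Qf^*\Big)+2\varepsilon Qf^*.$$ -/

import Mathlib

/-- A directed multigraph with edge set `E` on the vertex set `V`, with a source, a sink and a
capacity (possibly `⊤`, i.e. unbounded) on every edge. -/
structure FlowNetwork (V E : Type*) where
  src : E → V
  tgt : E → V
  source : V
  sink : V
  cap : E → EReal

namespace FlowNetwork

variable {V E : Type*}

/-- There is a directed edge from `u` to `v`. -/
def Adj (N : FlowNetwork V E) (u v : V) : Prop :=
  ∃ e, N.src e = u ∧ N.tgt e = v

/-- There is no directed cycle. -/
def Acyclic (N : FlowNetwork V E) : Prop :=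
  ∀ v, ¬ Relation.TransGen N.Adj v v

/-- `N.Path u v n`: there is a directed walk with `n` edges from `u` to `v` (in an acyclic
network, walks are paths). -/
inductive Path (N : FlowNetwork V E) (u : V) : V → ℕ → Prop
  | nil : Path N u u 0
  | snoc {v w : V} {n : ℕ} : Path N u v n → N.Adj v w → Path N u w (n + 1)

/-- The level of `u`: the length of a longest path from the source to `u`
(and `0` if `u` cannot be reached from the source). -/
noncomputable def level (N : FlowNetwork V E) (u : V) : ℕ :=
  sSup {n | N.Path N.source u n}

/-- The depth of the network: the length of a longest path from the source to the sink. -/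
noncomputable def depth (N : FlowNetwork V E) : ℕ := N.level N.sink

variable [Fintype E]

open Classical in
noncomputable def outflow (N : FlowNetwork V E) (x : E → ℝ) (v : V) : ℝ :=
  ∑ e with N.src e = v, x e

open Classical in
noncomputable def inflow (N : FlowNetwork V E) (x : E → ℝ) (v : V) : ℝ :=
  ∑ e with N.tgt e = v, x e

/-- The net amount of flow leaving the source. -/
noncomputable def value (N : FlowNetwork V E) (x : E → ℝ) : ℝ :=
  N.outflow x N.source - N.inflow x N.source

/-- `x` obeys the capacities, and is conserved at every vertex except the source and the sink. -/
structure IsFlow (N : FlowNetwork V E) (x : E → ℝ) : Prop where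
  nonneg : ∀ e, 0 ≤ x e
  le_cap : ∀ e, (x e : EReal) ≤ N.cap e
  conserve : ∀ v, v ≠ N.source → v ≠ N.sink → N.inflow x v = N.outflow x v

/-- `v` can be reached from the source along edges of positive capacity. -/
def Reachable (N : FlowNetwork V E) (v : V) : Prop :=
  Relation.ReflTransGen (fun a b => ∃ e, N.src e = a ∧ N.tgt e = b ∧ 0 < N.cap e) N.source v

/-- A flow from the source to the sink such that every path from the source to the sink goes
through a saturated edge. -/
structure IsBlockingFlow (N : FlowNetwork V E) (z : E → ℝ) : Prop where
  isFlow : N.IsFlow z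
  value_nonneg : 0 ≤ N.value z
  blocking : ¬ Relation.ReflTransGen
    (fun a b => ∃ e, N.src e = a ∧ N.tgt e = b ∧ (z e : EReal) < N.cap e) N.source N.sink

/-- The cost `∑ qₑ xₑ - Q f`, where `f` is the amount of flow sent from source to sink. -/
noncomputable def cost (N : FlowNetwork V E) (q : E → ℝ) (Q : ℝ) (x : E → ℝ) : ℝ :=
  ∑ e, q e * x e - Q * N.value x

/-- `x` is an optimal solution of the min-cost flow problem with reward `Q` per unit. -/
def IsMinCostFlow (N : FlowNetwork V E) (q : E → ℝ) (Q : ℝ) (x : E → ℝ) : Prop :=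
  N.IsFlow x ∧ ∀ y, N.IsFlow y → N.cost q Q x ≤ N.cost q Q y

end FlowNetwork

/-- The input of `ScalingFlow`: a network, edge weights, bounds on the absolute values of the
weights, and the error tolerance. -/
structure ScalingInput (V E : Type*) where
  net : FlowNetwork V E
  w : E → ℝ
  wmin : ℝ
  wmax : ℝ
  tol : ℝ

/-- A state of `ScalingFlow`: the current scale, flow and vertex potentials. -/
structure ScalingState (V E : Type*) where
  scale : ℕ
  x : E → ℝ
  p : V → ℝ

namespace ScalingInput

variable {V E : Type*} (I : ScalingInput V E)

/-- The last scale `T = log₂ (wmax / wmin)`. -/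
noncomputable def lastScale : ℕ := ⌊Real.logb 2 (I.wmax / I.wmin)⌋₊

/-- The step size of scale `i`: it is `tol * wmax` at scale `0`, and halved at each new scale. -/
noncomputable def step (i : ℕ) : ℝ := I.tol * I.wmax / 2 ^ i

/-- The reduced weight of an edge. -/
def reducedWeight (p : V → ℝ) (e : E) : ℝ :=
  I.w e + p (I.net.src e) - p (I.net.tgt e)

open Classical in
/-- The eligible graph of flow `x` and potentials `p` at scale `i`, as a network on the same
vertices. The arc `Sum.inl e` is the residual arc of `e` in forward direction, and `Sum.inr e`
the one in backward direction. An arc has capacity `0` (is absent) if it is not eligible. -/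
noncomputable def eligible (i : ℕ) (x : E → ℝ) (p : V → ℝ) : FlowNetwork V (E ⊕ E) where
  src := Sum.elim I.net.src I.net.tgt
  tgt := Sum.elim I.net.tgt I.net.src
  source := I.net.source
  sink := I.net.sink
  cap := Sum.elim
    (fun e => if I.step i ≤ I.reducedWeight p e then I.net.cap e - (x e : EReal) else 0)
    (fun e => if I.reducedWeight p e ≤ 0 then (x e : EReal) else 0)

/-- Send the flow `z` of the eligible graph. -/
def augment (x : E → ℝ) (z : E ⊕ E → ℝ) (e : E) : ℝ :=
  x e + z (Sum.inl e) - z (Sum.inr e)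

open Classical in
/-- Dual adjustment: recompute the eligible graph, and lower the potentials of the vertices that
cannot be reached from the source in it. -/
noncomputable def dualAdjust (i : ℕ) (x : E → ℝ) (p : V → ℝ) (u : V) : ℝ :=
  if (I.eligible i x p).Reachable u then p u else p u - I.step i

/-- Dual rescale. -/
noncomputable def dualRescale (i : ℕ) (p : V → ℝ) (u : V) : ℝ :=
  p u + I.step i * I.net.level u

/-- Initially the flow is zero and the potential of `u` is `wmax` times its level. -/
noncomputable def init : ScalingState V E where
  scale := 0
  x := fun _ => 0
  p := fun u => I.wmax * I.net.level u

/-- The stopping rule of the inner loop. -/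
def ScaleDone (σ : ScalingState V E) : Prop :=
  (σ.scale < I.lastScale ∧
    σ.p I.net.sink = I.net.depth * I.wmax / 2 ^ (σ.scale + 1)) ∨
  (σ.scale = I.lastScale ∧ σ.p I.net.sink = 0)

/-- The algorithm has ended: the last scale is over. -/
def Final (σ : ScalingState V E) : Prop :=
  σ.scale = I.lastScale ∧ I.ScaleDone σ

variable [Fintype E]

/-- One step of `ScalingFlow`: either an iteration of the inner loop (eligibility labeling,
augmentation by some blocking flow, dual adjustment), or the passage to the next scale. -/
inductive Step : ScalingState V E → ScalingState V E → Prop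
  | iterate (σ : ScalingState V E) (z : E ⊕ E → ℝ) (hσ : ¬ I.ScaleDone σ)
      (hz : (I.eligible σ.scale σ.x σ.p).IsBlockingFlow z) :
      Step σ
        { scale := σ.scale
          x := augment σ.x z
          p := I.dualAdjust σ.scale (augment σ.x z) σ.p }
  | rescale (σ : ScalingState V E) (hσ : I.ScaleDone σ) (hT : σ.scale < I.lastScale) :
      Step σ
        { scale := σ.scale + 1
          x := σ.x
          p := I.dualRescale σ.scale σ.p }

/-- Every execution from the state, whichever blocking flows are chosen, reaches a final state
after finitely many steps. -/
inductive Halts : ScalingState V E → Prop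
  | final (σ : ScalingState V E) (hσ : I.Final σ) : Halts σ
  | step (σ : ScalingState V E) (hσ : ∃ τ, I.Step σ τ) (h : ∀ τ, I.Step σ τ → Halts τ) : Halts σ

/-- Some execution of `ScalingFlow` on input `I` returns the flow `x`. -/
def Returns (x : E → ℝ) : Prop :=
  ∃ σ, Relation.ReflTransGen I.Step I.init σ ∧ I.Final σ ∧ σ.x = x

end ScalingInput

/-- The maximum weight flow instance for min-cost flow with edge costs `q` and reward `Q`: the
costs are negated, and an edge of weight `Q` and unbounded capacity is added from the sink to
a new vertex, which becomes the sink. Both the new edge and the new vertex are `none`. -/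
noncomputable def minCostInput {V E : Type*} (G : FlowNetwork V E) (q : E → ℝ) (Q wmin wmax tol : ℝ) :
    ScalingInput (Option V) (Option E) where
  net :=
    { src := fun e => e.elim (some G.sink) (fun a => some (G.src a))
      tgt := fun e => e.elim none (fun a => some (G.tgt a))
      source := some G.source
      sink := none
      cap := fun e => e.elim ⊤ G.cap }
  w := fun e => e.elim Q (fun a => - q a)
  wmin := wmin
  wmax := wmax
  tol := tol

/-! The algorithm is a primal-dual method with relaxed complementary slackness. Write `δ` for the
current step, `η` for the tolerance and `D` for the depth. Throughout, residual forward edges have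
reduced weight below `2δ`. Flow-carrying edges should have reduced weight at least `-δ`; the
shortfall is their violation, created only when potentials are rescaled. Summing reduced weights
then compares the current flow with any other flow (`Invariant.weight_le`).

Violations are paid for by an amortised bound. In a scale before the last, `p_t` is at least the
target, so `D * δ ≤ 2η * p_t`. Eligible arcs never lose reduced weight, so sending value `v` gains
weight at least `p_t * v`. Hence `3 * δ * D` can be reserved per unit of flow out of `6η` times the
weight. A rescale spends half of this reserve, and the other half is exactly the reserve of the next
scale, whose step is half as large.

At the very end `p_t = 0`, and the error term `δ * ∑ x` is uncontrolled. While `p_t` is still of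
order `η * K`, with `wmin * ∑ x ≤ K * value x`, this term is absorbed by `p_t * value x`. So
optimality is certified at that moment and survives because the weight never decreases afterwards
(`Invariant.nearOpt_step`). For min-cost flow `K = Q + wmin`.

Termination: a blocking flow disconnects the sink, so every iteration lowers `p_t` by exactly one
step, and `η` being a power of `1/2` makes the distance to the target a multiple of the step. -/

namespace FlowNetwork

variable {V E : Type*}

/-! ### Conservation and summation by parts -/

section Conservation

variable [Fintype E]

theorem outflow_eq_sum_ite (N : FlowNetwork V E) [DecidableEq V] (x : E → ℝ) (v : V) :
    N.outflow x v = ∑ e, if N.src e = v then x e else 0 := by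
  rw [outflow, Finset.sum_filter]
  congr!

theorem inflow_eq_sum_ite (N : FlowNetwork V E) [DecidableEq V] (x : E → ℝ) (v : V) :
    N.inflow x v = ∑ e, if N.tgt e = v then x e else 0 := by
  rw [inflow, Finset.sum_filter]
  congr!

theorem sum_potential_diff_mul [Fintype V] (N : FlowNetwork V E) (x : E → ℝ) (p : V → ℝ) :
    ∑ e, (p (N.tgt e) - p (N.src e)) * x e = ∑ v, p v * (N.inflow x v - N.outflow x v) := by
  classical
  simp only [inflow_eq_sum_ite, outflow_eq_sum_ite, ← Finset.sum_sub_distrib, Finset.mul_sum]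
  rw [Finset.sum_comm]
  refine Finset.sum_congr rfl fun e _ => ?_
  simp only [mul_sub, mul_ite, mul_zero, Finset.sum_sub_distrib, Finset.sum_ite_eq,
    Finset.mem_univ, if_true, sub_mul]

theorem IsFlow.inflow_sink_sub_outflow_sink [Fintype V] {N : FlowNetwork V E} {x : E → ℝ}
    (hx : N.IsFlow x) (hst : N.source ≠ N.sink) :
    N.inflow x N.sink - N.outflow x N.sink = N.value x := by
  classical
  have h := N.sum_potential_diff_mul x (fun _ => 1)
  simp only [sub_self, zero_mul, Finset.sum_const_zero, one_mul] at h
  rw [← Finset.add_sum_erase _ _ (Finset.mem_univ N.source),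
    ← Finset.add_sum_erase _ _ (Finset.mem_erase.2 ⟨hst.symm, Finset.mem_univ N.sink⟩),
    Finset.sum_eq_zero (s := (Finset.univ.erase N.source).erase N.sink)] at h
  · rw [value]; linarith
  · intro v hv
    simp only [Finset.mem_erase, Finset.mem_univ, and_true] at hv
    rw [hx.conserve v hv.2 hv.1, sub_self]

theorem IsFlow.sum_potential_diff_mul [Fintype V] {N : FlowNetwork V E} {x : E → ℝ}
    (hx : N.IsFlow x) (hst : N.source ≠ N.sink) (p : V → ℝ) :
    ∑ e, (p (N.tgt e) - p (N.src e)) * x e = (p N.sink - p N.source) * N.value x := by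
  classical
  have ht := hx.inflow_sink_sub_outflow_sink hst
  rw [N.sum_potential_diff_mul, ← Finset.add_sum_erase _ _ (Finset.mem_univ N.source),
    ← Finset.add_sum_erase _ _ (Finset.mem_erase.2 ⟨hst.symm, Finset.mem_univ N.sink⟩),
    Finset.sum_eq_zero (s := (Finset.univ.erase N.source).erase N.sink), ht]
  · rw [value]; ring
  · intro v hv
    simp only [Finset.mem_erase, Finset.mem_univ, and_true] at hv
    rw [hx.conserve v hv.2 hv.1, sub_self, mul_zero]

theorem outflow_zero (N : FlowNetwork V E) (v : V) : N.outflow (fun _ => 0) v = 0 := by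
  simp [outflow]

theorem inflow_zero (N : FlowNetwork V E) (v : V) : N.inflow (fun _ => 0) v = 0 := by
  simp [inflow]

theorem value_zero (N : FlowNetwork V E) : N.value (fun _ => 0) = 0 := by
  simp [value, outflow_zero, inflow_zero]

theorem outflow_add_smul (N : FlowNetwork V E) (x y : E → ℝ) (c : ℝ) (v : V) :
    N.outflow (fun e => x e + c * y e) v = N.outflow x v + c * N.outflow y v := by
  simp only [outflow, Finset.sum_add_distrib, Finset.mul_sum]

theorem inflow_add_smul (N : FlowNetwork V E) (x y : E → ℝ) (c : ℝ) (v : V) :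
    N.inflow (fun e => x e + c * y e) v = N.inflow x v + c * N.inflow y v := by
  simp only [inflow, Finset.sum_add_distrib, Finset.mul_sum]

theorem isFlow_zero {N : FlowNetwork V E} (hcap : ∀ e, 0 ≤ N.cap e) :
    N.IsFlow (fun _ => 0) where
  nonneg _ := le_rfl
  le_cap e := by simpa using hcap e
  conserve v _ _ := by rw [inflow_zero, outflow_zero]

theorem IsFlow.value_le_sum {N : FlowNetwork V E} {x : E → ℝ} (hx : N.IsFlow x) :
    N.value x ≤ ∑ e, x e := by
  classical
  have h1 : N.outflow x N.source ≤ ∑ e, x e := by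
    rw [outflow]
    exact Finset.sum_le_sum_of_subset_of_nonneg (Finset.filter_subset _ _)
      fun e _ _ => hx.nonneg e
  have h2 : 0 ≤ N.inflow x N.source := Finset.sum_nonneg fun e _ => hx.nonneg e
  rw [value]; linarith

end Conservation

/-! ### Existence of blocking flows -/

section BlockingFlow

variable [Fintype E]

open Classical in
/-- A walk along unsaturated edges carries a unit of flow; it uses an edge of finite capacity
unless the whole walk runs along edges of unbounded capacity. -/
theorem exists_unit_flow_of_reflTransGen (N : FlowNetwork V E) (z : E → ℝ) {v : V}
    (h : Relation.ReflTransGen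
      (fun a b => ∃ e, N.src e = a ∧ N.tgt e = b ∧ (z e : EReal) < N.cap e) N.source v) :
    ∃ y : E → ℝ, (∀ e, 0 ≤ y e) ∧ (∀ e, 0 < y e → (z e : EReal) < N.cap e) ∧
      (∀ u, N.outflow y u - N.inflow y u =
        (if u = N.source then 1 else 0) - (if u = v then 1 else 0)) ∧
      ((∃ e, 0 < y e ∧ N.cap e ≠ ⊤) ∨
        Relation.ReflTransGen (fun a b => ∃ e, N.src e = a ∧ N.tgt e = b ∧ N.cap e = ⊤)
          N.source v) := by
  induction h with
  | refl =>
    exact ⟨fun _ => 0, fun _ => le_rfl, fun e he => absurd he (lt_irrefl _),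
      fun u => by rw [outflow_zero, inflow_zero]; ring, Or.inr .refl⟩
  | @tail b c _ hbc ih =>
    obtain ⟨y, hy0, hyz, hdiv, htop⟩ := ih
    obtain ⟨e, hb, hc, he⟩ := hbc
    have hs : ∀ a, 0 ≤ (Pi.single e 1 : E → ℝ) a := fun a => by
      rw [Pi.single_apply]; split_ifs <;> norm_num
    refine ⟨fun a => y a + 1 * (Pi.single e 1 : E → ℝ) a, fun a => ?_, fun a ha => ?_,
      fun u => ?_, ?_⟩
    · have := hs a; have := hy0 a; linarith
    · by_cases hae : a = e
      · rwa [hae]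
      · apply hyz
        simpa [Pi.single_apply, hae] using ha
    · have h1 : N.outflow (Pi.single e 1) u = if u = b then 1 else 0 := by
        rw [outflow_eq_sum_ite, Finset.sum_eq_single e (fun a _ ha => by simp [ha]) (by simp), hb]
        simp [eq_comm]
      have h2 : N.inflow (Pi.single e 1) u = if u = c then 1 else 0 := by
        rw [inflow_eq_sum_ite, Finset.sum_eq_single e (fun a _ ha => by simp [ha]) (by simp), hc]
        simp [eq_comm]
      rw [outflow_add_smul, inflow_add_smul, h1, h2]
      linarith [hdiv u]
    · by_cases het : N.cap e = ⊤
      · rcases htop with ⟨a, ha, hat⟩ | htop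
        · exact Or.inl ⟨a, by have := hs a; linarith, hat⟩
        · exact Or.inr (htop.tail ⟨e, hb, hc, het⟩)
      · exact Or.inl ⟨e, by have := hy0 e; simp; linarith, het⟩

/-- Repeated augmentation along unsaturated walks: each round saturates another edge of finite
capacity and unsaturates none, so the number of unsaturated edges drops. Existence is needed because
`Halts` demands that a non-final state has a successor. -/
theorem exists_isBlockingFlow {N : FlowNetwork V E} (hst : N.source ≠ N.sink)
    (hcap : ∀ e, 0 ≤ N.cap e)
    (htop : ¬ Relation.ReflTransGen (fun a b => ∃ e, N.src e = a ∧ N.tgt e = b ∧ N.cap e = ⊤)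
      N.source N.sink) : ∃ z, N.IsBlockingFlow z := by
  classical
  suffices H : ∀ (n : ℕ) (z : E → ℝ), N.IsFlow z → 0 ≤ N.value z →
      (Finset.univ.filter fun e => (z e : EReal) < N.cap e).card = n →
      ∃ z, N.IsBlockingFlow z from
    H _ _ (isFlow_zero hcap) (value_zero N).ge rfl
  intro n
  induction n using Nat.strong_induction_on with
  | _ n ih =>
    intro z hz hz0 hn
    by_cases hpath : Relation.ReflTransGen
      (fun a b => ∃ e, N.src e = a ∧ N.tgt e = b ∧ (z e : EReal) < N.cap e) N.source N.sink
    swap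
    · exact ⟨z, hz, hz0, hpath⟩
    obtain ⟨y, hy0, hyz, hdiv, hy⟩ := N.exists_unit_flow_of_reflTransGen z hpath
    obtain ⟨e₀, he₀, he₀t⟩ := hy.resolve_right htop
    have hreal : ∀ e, N.cap e ≠ ⊤ → ((N.cap e).toReal : EReal) = N.cap e := fun e he =>
      EReal.coe_toReal he (ne_bot_of_gt (lt_of_lt_of_le (EReal.bot_lt_zero) (hcap e)))
    -- The bottleneck edge `m`. Dividing by `y e` accounts for walks that use an edge several times.
    obtain ⟨m, hm, hmin⟩ := (Finset.univ.filter fun e => 0 < y e ∧ N.cap e ≠ ⊤).exists_min_image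
      (fun e => ((N.cap e).toReal - z e) / y e) ⟨e₀, by simp [he₀, he₀t]⟩
    simp only [Finset.mem_filter, Finset.mem_univ, true_and] at hm hmin
    set c := ((N.cap m).toReal - z m) / y m with hc
    have hzm : z m < (N.cap m).toReal := by
      have := hyz m hm.1
      rw [← hreal m hm.2] at this
      exact_mod_cast this
    have hc0 : 0 < c := div_pos (by linarith) hm.1
    have hle : ∀ e, ((z e + c * y e : ℝ) : EReal) ≤ N.cap e := by
      intro e
      by_cases het : N.cap e = ⊤
      · rw [het]; exact le_top
      rcases (hy0 e).eq_or_lt with h | h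
      · rw [← h, mul_zero, add_zero]; exact hz.le_cap e
      · have := hmin e ⟨h, het⟩
        rw [le_div_iff₀ h] at this
        rw [← hreal e het]
        exact_mod_cast (by linarith : z e + c * y e ≤ (N.cap e).toReal)
    have hval : N.value (fun e => z e + c * y e) = N.value z + c := by
      have := hdiv N.source
      rw [if_pos rfl, if_neg hst] at this
      rw [value, value, outflow_add_smul, inflow_add_smul]
      linear_combination c * this
    refine ih _ ?_ (fun e => z e + c * y e) ⟨fun e => ?_, hle, fun v hs ht => ?_⟩ ?_ rfl
    · rw [← hn]
      apply Finset.card_lt_card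
      rw [Finset.ssubset_iff_of_subset]
      · refine ⟨m, by simpa using hyz m hm.1, ?_⟩
        simp only [Finset.mem_filter, Finset.mem_univ, true_and, not_lt]
        rw [← hreal m hm.2, hc, div_mul_cancel₀ _ hm.1.ne']
        simp
      · intro e he
        simp only [Finset.mem_filter, Finset.mem_univ, true_and] at he ⊢
        refine lt_of_le_of_lt ?_ he
        exact_mod_cast (by nlinarith [hy0 e] : z e ≤ z e + c * y e)
    · have := hz.nonneg e
      have := mul_nonneg hc0.le (hy0 e)
      linarith
    · have := hdiv v
      rw [if_neg hs, if_neg ht] at this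
      rw [outflow_add_smul, inflow_add_smul, hz.conserve v hs ht]
      linear_combination - c * this
    · rw [hval]; linarith

end BlockingFlow

/-! ### Levels in an acyclic network -/

section Level

theorem Path.eq_or_transGen {N : FlowNetwork V E} {u v : V} {n : ℕ} (h : N.Path u v n) :
    (n = 0 ∧ u = v) ∨ Relation.TransGen N.Adj u v := by
  induction h with
  | nil => exact Or.inl ⟨rfl, rfl⟩
  | snoc _ hvw ih =>
    rcases ih with ⟨_, rfl⟩ | ih
    · exact Or.inr (.single hvw)
    · exact Or.inr (ih.tail hvw)

theorem level_eq_zero {N : FlowNetwork V E} {u : V} (h : ¬ ∃ n, N.Path N.source u n) : N.level u = 0 := by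
  have : {n | N.Path N.source u n} = ∅ := by
    ext n; exact ⟨fun hn => h ⟨n, hn⟩, fun hn => hn.elim⟩
  rw [level, this, csSup_empty]; rfl

variable [Finite V] {N : FlowNetwork V E}

/-- The set of strict ancestors grows strictly along every edge, since no vertex is its own
ancestor. -/
theorem Acyclic.length_le (hN : N.Acyclic) {u v : V} {n : ℕ} (h : N.Path u v n) :
    n ≤ {a | Relation.TransGen N.Adj a v}.ncard := by
  induction h with
  | nil => exact Nat.zero_le _
  | @snoc v w n _ hvw ih =>
    refine (Nat.add_le_add_right ih 1).trans ?_
    have hv : v ∉ {a | Relation.TransGen N.Adj a v} := hN v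
    rw [← Set.ncard_insert_of_notMem hv (Set.toFinite _)]
    refine Set.ncard_le_ncard ?_ (Set.toFinite _)
    rintro a (rfl | ha)
    · exact .single hvw
    · exact ha.tail hvw

theorem Acyclic.bddAbove_lengths (hN : N.Acyclic) (u v : V) : BddAbove {n | N.Path u v n} :=
  ⟨_, fun _ h => hN.length_le h⟩

theorem Acyclic.path_level (hN : N.Acyclic) {u : V} (h : ∃ n, N.Path N.source u n) :
    N.Path N.source u (N.level u) :=
  Nat.sSup_mem h (hN.bddAbove_lengths _ _)

theorem Acyclic.level_add_one_le (hN : N.Acyclic) {u v : V}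
    (h : ∃ n, N.Path N.source u n) (huv : N.Adj u v) : N.level u + 1 ≤ N.level v :=
  le_csSup (hN.bddAbove_lengths _ _) ((hN.path_level h).snoc huv)

theorem Acyclic.level_source (hN : N.Acyclic) : N.level N.source = 0 := by
  rcases (hN.path_level ⟨0, .nil⟩).eq_or_transGen with h | h
  · exact h.1
  · exact absurd h (hN _)

end Level

end FlowNetwork

/-! ### Standing hypotheses and invariants -/

namespace ScalingInput

variable {V E : Type*}

/-- The hypotheses under which `ScalingFlow` is analysed. -/
structure Admissible (I : ScalingInput V E) : Prop where
  acyclic : I.net.Acyclic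
  source_ne_sink : I.net.source ≠ I.net.sink
  cap_nonneg : ∀ e, 0 ≤ I.net.cap e
  no_top_path : ¬ Relation.ReflTransGen
    (fun a b => ∃ e, I.net.src e = a ∧ I.net.tgt e = b ∧ I.net.cap e = ⊤) I.net.source I.net.sink
  sink_reachable : ∃ n, I.net.Path I.net.source I.net.sink n
  wmin_pos : 0 < I.wmin
  wmax_eq : I.wmax = 2 ^ I.lastScale * I.wmin
  w_le : ∀ e, I.w e ≤ I.wmax
  -- Vertices unreachable from the source get the default level `0`, so levels need not increase
  -- along edges leaving them. Negative weight keeps such edges out of play.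
  w_neg : ∀ e, (¬ ∃ n, I.net.Path I.net.source (I.net.src e) n) → I.w e < 0
  tol_eq : ∃ k, I.tol = (1 / 2) ^ (k + 1)

/-- The potential of the sink at which a scale ends. -/
noncomputable def target (I : ScalingInput V E) (i : ℕ) : ℝ :=
  if i < I.lastScale then I.net.depth * I.wmax / 2 ^ (i + 1) else 0

/-- The amount by which the reduced weight of an edge violates the bound `-step i`. -/
noncomputable def violation (I : ScalingInput V E) (i : ℕ) (p : V → ℝ) (e : E) : ℝ :=
  max 0 (- I.reducedWeight p e - I.step i)

theorem violation_nonneg (I : ScalingInput V E) (i : ℕ) (p : V → ℝ) (e : E) :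
    0 ≤ I.violation i p e := le_max_left _ _

theorem violation_le_of_le (I : ScalingInput V E) (i : ℕ) {p p' : V → ℝ} {e : E}
    (h : I.reducedWeight p e ≤ I.reducedWeight p' e) :
    I.violation i p' e ≤ I.violation i p e :=
  max_le_max le_rfl (by linarith)

theorem scaleDone_iff (I : ScalingInput V E) {σ : ScalingState V E} (h : σ.scale ≤ I.lastScale) :
    I.ScaleDone σ ↔ σ.p I.net.sink = I.target σ.scale := by
  rw [ScaleDone, target]
  split_ifs with hlt
  · simp [hlt, hlt.ne]
  · simp [le_antisymm h (not_lt.1 hlt)]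

theorem step_succ (I : ScalingInput V E) (i : ℕ) : I.step (i + 1) = I.step i / 2 := by
  rw [step, step, pow_succ]; ring

section

variable [Fintype E]

/-- The total weight of a flow. -/
noncomputable def weight (I : ScalingInput V E) (x : E → ℝ) : ℝ := ∑ e, I.w e * x e

theorem weight_zero (I : ScalingInput V E) : I.weight (fun _ => 0) = 0 := by simp [weight]

/-- The total violation of the flow-carrying edges. -/
noncomputable def totalViolation (I : ScalingInput V E) (σ : ScalingState V E) : ℝ :=
  ∑ e, σ.x e * I.violation σ.scale σ.p e

/-- The invariants of `ScalingFlow`. -/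
structure Invariant (I : ScalingInput V E) (σ : ScalingState V E) : Prop where
  scale_le : σ.scale ≤ I.lastScale
  isFlow : I.net.IsFlow σ.x
  value_nonneg : 0 ≤ I.net.value σ.x
  p_source : σ.p I.net.source = 0
  unreachable : ∀ e, (¬ ∃ n, I.net.Path I.net.source (I.net.src e) n) →
    σ.x e = 0 ∧ I.reducedWeight σ.p e < 0
  residual : ∀ e, (σ.x e : EReal) < I.net.cap e → I.reducedWeight σ.p e < 2 * I.step σ.scale
  p_sink : ∃ k : ℕ, σ.p I.net.sink = I.target σ.scale + k * I.step σ.scale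
  -- The extra term is the reserve for the violations that later rescales will create; none follows
  -- the last scale.
  totalViolation_le : I.totalViolation σ + (if σ.scale < I.lastScale then
    3 * I.step σ.scale * I.net.depth * I.net.value σ.x else 0) ≤ 6 * I.tol * I.weight σ.x

/-- Compared with `y`, the flow of the state is nearly as good, provided that the potential of the
sink has dropped to `b` in the last scale. -/
def NearOpt (I : ScalingInput V E) (b : ℝ) (y : E → ℝ) (σ : ScalingState V E) : Prop :=
  σ.scale = I.lastScale → σ.p I.net.sink ≤ b →
    I.weight y ≤ (1 + 6 * I.tol) * I.weight σ.x + 2 * I.step I.lastScale * ∑ e, y e +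
      b * I.net.value y

end

namespace Admissible

variable {I : ScalingInput V E}

theorem tol_pos (hI : I.Admissible) : 0 < I.tol := by
  obtain ⟨k, hk⟩ := hI.tol_eq; rw [hk]; positivity

theorem wmax_pos (hI : I.Admissible) : 0 < I.wmax := by
  have := hI.wmin_pos; rw [hI.wmax_eq]; positivity

theorem step_pos (hI : I.Admissible) (i : ℕ) : 0 < I.step i := by
  have := hI.wmax_pos; have := hI.tol_pos; rw [step]; positivity

theorem step_lastScale (hI : I.Admissible) : I.step I.lastScale = I.tol * I.wmin := by
  rw [step, hI.wmax_eq]; field_simp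

/-- The potential of the sink at the start of a scale is the target plus a multiple of the step. -/
theorem exists_start_eq (hI : I.Admissible) (i : ℕ) :
    ∃ k : ℕ, I.net.depth * (I.wmax / 2 ^ i) = I.target i + k * I.step i := by
  obtain ⟨j, hj⟩ := hI.tol_eq
  have h : (2 : ℝ) ^ (j + 1) * I.tol = 1 := by rw [hj, ← mul_pow]; norm_num
  by_cases hi : i < I.lastScale
  · refine ⟨I.net.depth * 2 ^ j, ?_⟩
    rw [target, if_pos hi, step]
    push_cast
    rw [pow_succ] at h
    field_simp
    rw [pow_succ]
    linear_combination -(I.net.depth : ℝ) * I.wmax * 2 ^ i * h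
  · refine ⟨I.net.depth * 2 ^ (j + 1), ?_⟩
    rw [target, if_neg hi, step]
    push_cast
    field_simp
    linear_combination -(I.net.depth : ℝ) * I.wmax * h

theorem target_nonneg (hI : I.Admissible) (i : ℕ) : 0 ≤ I.target i := by
  have := hI.wmax_pos
  rw [target]
  split_ifs <;> positivity

theorem tol_mul_le_p_sink_init (hI : I.Admissible) (hT : I.lastScale = 0)
    (hη : I.tol ≤ 1) :
    I.tol * (I.net.depth * I.wmin) ≤ I.init.p I.net.sink := by
  have h1 := hI.wmax_eq
  rw [hT, pow_zero, one_mul] at h1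
  have := hI.wmin_pos
  simp only [init]
  rw [h1, FlowNetwork.depth, mul_comm I.wmin]
  exact mul_le_of_le_one_left (by positivity) hη

section

variable [Fintype E]

theorem eligible_cap_nonneg {i : ℕ} {x : E → ℝ} {p : V → ℝ}
    (hx : I.net.IsFlow x) (a : E ⊕ E) : 0 ≤ (I.eligible i x p).cap a := by
  rcases a with e | e
  · simp only [eligible, Sum.elim_inl]
    split_ifs
    · exact (EReal.sub_nonneg (Or.inr (EReal.coe_ne_top _)) (Or.inr (EReal.coe_ne_bot _))).2
        (hx.le_cap e)
    · exact le_rfl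
  · simp only [eligible, Sum.elim_inr]
    split_ifs
    · exact_mod_cast hx.nonneg e
    · exact le_rfl

theorem exists_blockingFlow (hI : I.Admissible) {i : ℕ} {x : E → ℝ} {p : V → ℝ}
    (hx : I.net.IsFlow x) : ∃ z, (I.eligible i x p).IsBlockingFlow z := by
  refine FlowNetwork.exists_isBlockingFlow hI.source_ne_sink (eligible_cap_nonneg hx) ?_
  intro h
  refine hI.no_top_path (Relation.ReflTransGen.mono ?_ _ _ h)
  rintro a b ⟨e | e, ha, hb, he⟩
  · refine ⟨e, ha, hb, ?_⟩
    simp only [eligible, Sum.elim_inl] at he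
    split_ifs at he
    · by_contra hne
      have hbot : I.net.cap e ≠ ⊥ :=
        ne_bot_of_gt (lt_of_lt_of_le EReal.bot_lt_zero (hI.cap_nonneg e))
      rw [← EReal.coe_toReal hne hbot, ← EReal.coe_sub] at he
      exact EReal.coe_ne_top _ he
    · exact absurd he EReal.zero_ne_top
  · simp only [eligible, Sum.elim_inr] at he
    split_ifs at he
    · exact absurd he (EReal.coe_ne_top _)
    · exact absurd he EReal.zero_ne_top

end

end Admissible

end ScalingInput

/-! ### Effect of one augmentation and one dual adjustment -/

namespace ScalingInput

variable {V E : Type*} {I : ScalingInput V E}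

section

variable [Fintype E]

theorem isFlow_eligible_inl {i : ℕ} {x : E → ℝ} {p : V → ℝ} {z : E ⊕ E → ℝ}
    (hz : (I.eligible i x p).IsFlow z) (e : E) :
    I.reducedWeight p e < I.step i → z (Sum.inl e) = 0 := by
  intro h
  have h1 := hz.le_cap (Sum.inl e)
  simp only [eligible, Sum.elim_inl, if_neg (not_le.2 h)] at h1
  exact le_antisymm (by exact_mod_cast h1) (hz.nonneg _)

theorem isFlow_eligible_inr {i : ℕ} {x : E → ℝ} {p : V → ℝ} {z : E ⊕ E → ℝ}
    (hz : (I.eligible i x p).IsFlow z) (e : E) :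
    0 < I.reducedWeight p e → z (Sum.inr e) = 0 := by
  intro h
  have h1 := hz.le_cap (Sum.inr e)
  simp only [eligible, Sum.elim_inr, if_neg (not_le.2 h)] at h1
  exact le_antisymm (by exact_mod_cast h1) (hz.nonneg _)

theorem isFlow_eligible_inr_le {i : ℕ} {x : E → ℝ} {p : V → ℝ} {z : E ⊕ E → ℝ}
    (hx : I.net.IsFlow x) (hz : (I.eligible i x p).IsFlow z) (e : E) :
    z (Sum.inr e) ≤ x e := by
  have h1 := hz.le_cap (Sum.inr e)
  simp only [eligible, Sum.elim_inr] at h1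
  split_ifs at h1
  · exact_mod_cast h1
  · exact le_trans (by exact_mod_cast h1) (hx.nonneg e)

theorem isFlow_eligible_inl_le {i : ℕ} {x : E → ℝ} {p : V → ℝ} {z : E ⊕ E → ℝ}
    (hx : I.net.IsFlow x) (hz : (I.eligible i x p).IsFlow z) (e : E) :
    ((x e + z (Sum.inl e) : ℝ) : EReal) ≤ I.net.cap e := by
  have h1 := hz.le_cap (Sum.inl e)
  simp only [eligible, Sum.elim_inl] at h1
  split_ifs at h1
  · rw [EReal.le_sub_iff_add_le (Or.inl (EReal.coe_ne_bot _)) (Or.inl (EReal.coe_ne_top _))] at h1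
    rwa [add_comm, EReal.coe_add]
  · have h0 : z (Sum.inl e) = 0 := le_antisymm (by exact_mod_cast h1) (hz.nonneg _)
    rw [h0, add_zero]
    exact hx.le_cap e

theorem outflow_augment_sub_inflow_augment (i : ℕ) (x : E → ℝ) (p : V → ℝ) (z : E ⊕ E → ℝ)
    (v : V) : I.net.outflow (augment x z) v - I.net.inflow (augment x z) v =
      (I.net.outflow x v - I.net.inflow x v) +
        ((I.eligible i x p).outflow z v - (I.eligible i x p).inflow z v) := by
  classical
  have h1 : (I.eligible i x p).outflow z v =
      I.net.outflow (fun e => z (Sum.inl e)) v + I.net.inflow (fun e => z (Sum.inr e)) v := by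
    simp only [FlowNetwork.outflow_eq_sum_ite, FlowNetwork.inflow_eq_sum_ite,
      Fintype.sum_sum_type]
    rfl
  have h2 : (I.eligible i x p).inflow z v =
      I.net.inflow (fun e => z (Sum.inl e)) v + I.net.outflow (fun e => z (Sum.inr e)) v := by
    simp only [FlowNetwork.outflow_eq_sum_ite, FlowNetwork.inflow_eq_sum_ite,
      Fintype.sum_sum_type]
    rfl
  rw [h1, h2]
  simp only [FlowNetwork.outflow, FlowNetwork.inflow, augment, Finset.sum_add_distrib,
    Finset.sum_sub_distrib]
  ring

theorem value_augment (i : ℕ) (x : E → ℝ) (p : V → ℝ) (z : E ⊕ E → ℝ) :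
    I.net.value (augment x z) = I.net.value x + (I.eligible i x p).value z :=
  outflow_augment_sub_inflow_augment i x p z _

theorem isFlow_augment {i : ℕ} {x : E → ℝ} {p : V → ℝ}
    {z : E ⊕ E → ℝ} (hx : I.net.IsFlow x) (hz : (I.eligible i x p).IsFlow z) :
    I.net.IsFlow (augment x z) where
  nonneg e := by
    have h1 := isFlow_eligible_inr_le hx hz e
    have h2 := hz.nonneg (Sum.inl e)
    rw [augment]; linarith
  le_cap e := by
    refine le_trans ?_ (isFlow_eligible_inl_le hx hz e)
    have h2 := hz.nonneg (Sum.inr e)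
    rw [augment]
    exact_mod_cast (by linarith)
  conserve v hs ht := by
    have h1 := outflow_augment_sub_inflow_augment (I := I) i x p z v
    have h2 := hx.conserve v hs ht
    have h3 := hz.conserve v hs ht
    linarith

theorem weight_eq [Fintype V] (hst : I.net.source ≠ I.net.sink) {y : E → ℝ}
    (hy : I.net.IsFlow y) (p : V → ℝ) :
    I.weight y = ∑ e, I.reducedWeight p e * y e +
      (p I.net.sink - p I.net.source) * I.net.value y := by
  rw [← hy.sum_potential_diff_mul hst, weight, ← Finset.sum_add_distrib]
  refine Finset.sum_congr rfl fun e _ => ?_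
  rw [reducedWeight]; ring

/-- Forward eligible arcs have positive reduced weight and backward ones nonpositive, so `z` does
not lose reduced weight; the potentials contribute `p_t` times the value of `z`. -/
theorem weight_augment_ge [Fintype V] (hst : I.net.source ≠ I.net.sink) {i : ℕ}
    (hδ : 0 < I.step i) {x : E → ℝ} {p : V → ℝ} (hp : p I.net.source = 0) {z : E ⊕ E → ℝ}
    (hz : (I.eligible i x p).IsFlow z) :
    I.weight x + p I.net.sink * (I.eligible i x p).value z ≤ I.weight (augment x z) := by
  have h1 := hz.sum_potential_diff_mul hst p
  have h2 : (p (I.eligible i x p).sink - p (I.eligible i x p).source) = p I.net.sink := by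
    change p I.net.sink - p I.net.source = _
    rw [hp, sub_zero]
  rw [h2, Fintype.sum_sum_type] at h1
  rw [← h1, weight, weight, ← Finset.sum_add_distrib, ← Finset.sum_add_distrib]
  refine Finset.sum_le_sum fun e _ => ?_
  have h3 : 0 ≤ I.reducedWeight p e * (z (Sum.inl e) - z (Sum.inr e)) := by
    rcases le_or_gt (I.reducedWeight p e) 0 with h | h
    · rw [isFlow_eligible_inl hz e (h.trans_lt hδ)]
      nlinarith [hz.nonneg (Sum.inr e)]
    · rw [isFlow_eligible_inr hz e h]
      nlinarith [hz.nonneg (Sum.inl e)]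
  rw [reducedWeight] at h3
  simp only [eligible, Sum.elim_inl, Sum.elim_inr, augment]
  linarith

/-- A blocking flow disconnects the sink from the source. -/
theorem not_reachable_sink_of_isBlockingFlow {i : ℕ} (hδ : 0 < I.step i) {x : E → ℝ} {p : V → ℝ}
    {z : E ⊕ E → ℝ} (hz : (I.eligible i x p).IsBlockingFlow z) :
    ¬ (I.eligible i (augment x z) p).Reachable I.net.sink := by
  intro h
  refine hz.blocking (Relation.ReflTransGen.mono ?_ _ _ h)
  rintro a b ⟨e | e, ha, hb, he⟩
  · refine ⟨Sum.inl e, ha, hb, ?_⟩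
    simp only [eligible, Sum.elim_inl] at he ⊢
    split_ifs at he with h1
    · have hr := isFlow_eligible_inr hz.isFlow e (hδ.trans_le h1)
      rw [if_pos h1]
      rw [EReal.sub_pos, augment, hr, sub_zero] at he
      rw [EReal.lt_sub_iff_add_lt (Or.inl (EReal.coe_ne_bot _)) (Or.inl (EReal.coe_ne_top _))]
      rwa [add_comm, ← EReal.coe_add]
    · exact absurd he (lt_irrefl _)
  · refine ⟨Sum.inr e, ha, hb, ?_⟩
    simp only [eligible, Sum.elim_inr] at he ⊢
    split_ifs at he with h1
    · have hl := isFlow_eligible_inl hz.isFlow e (h1.trans_lt hδ)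
      rw [if_pos h1]
      rw [augment, hl, add_zero] at he
      have he' : 0 < x e - z (Sum.inr e) := by exact_mod_cast he
      exact_mod_cast (by linarith : z (Sum.inr e) < x e)
    · exact absurd he (lt_irrefl _)

end

theorem reachable_tgt {i : ℕ} {x : E → ℝ} {p : V → ℝ} {e : E}
    (h : (I.eligible i x p).Reachable (I.net.src e)) (hw : I.step i ≤ I.reducedWeight p e)
    (hx : (x e : EReal) < I.net.cap e) : (I.eligible i x p).Reachable (I.net.tgt e) := by
  refine Relation.ReflTransGen.tail h ⟨Sum.inl e, rfl, rfl, ?_⟩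
  simp only [eligible, Sum.elim_inl, if_pos hw]
  rwa [EReal.sub_pos]

theorem reachable_src {i : ℕ} {x : E → ℝ} {p : V → ℝ} {e : E}
    (h : (I.eligible i x p).Reachable (I.net.tgt e)) (hw : I.reducedWeight p e ≤ 0)
    (hx : 0 < x e) : (I.eligible i x p).Reachable (I.net.src e) := by
  refine Relation.ReflTransGen.tail h ⟨Sum.inr e, rfl, rfl, ?_⟩
  simp only [eligible, Sum.elim_inr, if_pos hw]
  exact_mod_cast hx

theorem reachable_source (i : ℕ) (x : E → ℝ) (p : V → ℝ) :
    (I.eligible i x p).Reachable I.net.source := .refl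

theorem exists_path_of_reachable {i : ℕ} {x : E → ℝ} {p : V → ℝ}
    (hx : ∀ e, (¬ ∃ n, I.net.Path I.net.source (I.net.src e) n) → x e = 0) {v : V}
    (h : (I.eligible i x p).Reachable v) : ∃ n, I.net.Path I.net.source v n := by
  rw [FlowNetwork.Reachable] at h
  induction h with
  | refl => exact ⟨0, .nil⟩
  | tail _ hbc ih =>
    obtain ⟨n, hn⟩ := ih
    obtain ⟨e | e, ha, hb, he⟩ := hbc
    · exact ⟨n + 1, hn.snoc ⟨e, ha, hb⟩⟩
    · by_contra hc
      rw [← hb] at hc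
      simp only [eligible, Sum.elim_inr, hx e hc] at he
      split_ifs at he <;> exact absurd he (by simp)

/-- The reduced weight can rise only if the head is lowered and the tail is not, that is, if the
edge leaves the reachable set. -/
theorem reducedWeight_dualAdjust_le {i : ℕ} (hδ : 0 < I.step i) (x : E → ℝ) (p : V → ℝ) (e : E)
    (h : (I.eligible i x p).Reachable (I.net.src e) →
      (I.eligible i x p).Reachable (I.net.tgt e)) :
    I.reducedWeight (I.dualAdjust i x p) e ≤ I.reducedWeight p e := by
  simp only [reducedWeight, dualAdjust]
  split_ifs <;> first | linarith | tauto

theorem le_reducedWeight_dualAdjust {i : ℕ} (hδ : 0 < I.step i) (x : E → ℝ) (p : V → ℝ) (e : E)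
    (h : (I.eligible i x p).Reachable (I.net.tgt e) →
      (I.eligible i x p).Reachable (I.net.src e)) :
    I.reducedWeight p e ≤ I.reducedWeight (I.dualAdjust i x p) e := by
  simp only [reducedWeight, dualAdjust]
  split_ifs <;> first | linarith | tauto

theorem abs_reducedWeight_dualAdjust_sub {i : ℕ} (hδ : 0 < I.step i) (x : E → ℝ) (p : V → ℝ)
    (e : E) : |I.reducedWeight (I.dualAdjust i x p) e - I.reducedWeight p e| ≤ I.step i := by
  simp only [reducedWeight, dualAdjust]
  rw [abs_le]
  split_ifs <;> constructor <;> linarith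

theorem reducedWeight_dualRescale (i : ℕ) (p : V → ℝ) (e : E) :
    I.reducedWeight (I.dualRescale i p) e = I.reducedWeight p e -
      I.step i * (I.net.level (I.net.tgt e) - I.net.level (I.net.src e)) := by
  simp only [reducedWeight, dualRescale]; ring

end ScalingInput

/-! ### Preservation of the invariants and near-optimality -/

namespace ScalingInput

variable {V E : Type*} {I : ScalingInput V E} [Fintype E]

theorem totalViolation_nonneg {σ : ScalingState V E} (hx : I.net.IsFlow σ.x) :
    0 ≤ I.totalViolation σ :=
  Finset.sum_nonneg fun e _ => mul_nonneg (hx.nonneg e) (I.violation_nonneg _ _ e)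

theorem Invariant.weight_nonneg (hI : I.Admissible) {σ : ScalingState V E} (h : I.Invariant σ) :
    0 ≤ I.weight σ.x := by
  have h1 := h.totalViolation_le
  have h2 := totalViolation_nonneg h.isFlow
  have h3 := hI.tol_pos
  have h4 : 0 ≤ 6 * I.tol * I.weight σ.x := by
    refine le_trans (add_nonneg h2 ?_) h1
    split_ifs
    · have := hI.step_pos σ.scale
      have := h.value_nonneg
      positivity
    · exact le_rfl
  exact nonneg_of_mul_nonneg_right h4 (by positivity)

theorem Invariant.level_src_add_one_le [Fintype V] (hI : I.Admissible) {σ : ScalingState V E}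
    (h : I.Invariant σ) {e : E} (he : σ.x e ≠ 0) :
    (I.net.level (I.net.src e) : ℝ) + 1 ≤ I.net.level (I.net.tgt e) := by
  have hr : ∃ n, I.net.Path I.net.source (I.net.src e) n := by
    by_contra hc
    exact he (h.unreachable e hc).1
  exact_mod_cast hI.acyclic.level_add_one_le hr ⟨e, rfl, rfl⟩

theorem Invariant.sum_level_diff_mul [Fintype V] (hI : I.Admissible) {σ : ScalingState V E}
    (h : I.Invariant σ) :
    ∑ e, ((I.net.level (I.net.tgt e) : ℝ) - I.net.level (I.net.src e)) * σ.x e =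
      I.net.depth * I.net.value σ.x := by
  rw [h.isFlow.sum_potential_diff_mul hI.source_ne_sink (fun v => (I.net.level v : ℝ)),
    hI.acyclic.level_source, FlowNetwork.depth, Nat.cast_zero, sub_zero]

/-- Every flow-carrying edge climbs at least one level, and the total climb of the flow is the depth
times its value. -/
theorem Invariant.sum_le [Fintype V] (hI : I.Admissible) {σ : ScalingState V E} (h : I.Invariant σ) :
    ∑ e, σ.x e ≤ I.net.depth * I.net.value σ.x := by
  rw [← h.sum_level_diff_mul hI]
  refine Finset.sum_le_sum fun e _ => ?_
  rcases (h.isFlow.nonneg e).eq_or_lt with he | he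
  · rw [← he, mul_zero]
  · nlinarith [h.level_src_add_one_le hI he.ne']

/-- Edge by edge: where `y` exceeds the flow the edge is residual, so its reduced weight is below
`2δ`; elsewhere the reduced weight is at least `-δ` minus the violation. Potential differences
telescope to the `p_t` term. -/
theorem Invariant.weight_le [Fintype V] (hI : I.Admissible) {σ : ScalingState V E} (h : I.Invariant σ)
    {y : E → ℝ} (hy : I.net.IsFlow y) :
    I.weight y ≤ I.weight σ.x + σ.p I.net.sink * (I.net.value y - I.net.value σ.x) +
      2 * I.step σ.scale * ∑ e, y e + I.step σ.scale * ∑ e, σ.x e + I.totalViolation σ := by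
  have hδ := hI.step_pos σ.scale
  have hsum : ∑ e, I.reducedWeight σ.p e * y e - ∑ e, I.reducedWeight σ.p e * σ.x e ≤
      2 * I.step σ.scale * ∑ e, y e + I.step σ.scale * ∑ e, σ.x e + I.totalViolation σ := by
    rw [totalViolation, Finset.mul_sum, Finset.mul_sum, ← Finset.sum_add_distrib,
      ← Finset.sum_add_distrib, ← Finset.sum_sub_distrib]
    refine Finset.sum_le_sum fun e _ => ?_
    have hx0 := h.isFlow.nonneg e
    have hy0 := hy.nonneg e
    have hv0 := I.violation_nonneg σ.scale σ.p e
    have hv : - I.reducedWeight σ.p e - I.step σ.scale ≤ I.violation σ.scale σ.p e :=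
      le_max_right _ _
    rw [← mul_sub]
    rcases lt_or_ge (σ.x e) (y e) with hlt | hle
    · have hr := h.residual e (lt_of_lt_of_le (by exact_mod_cast hlt) (hy.le_cap e))
      have h1 := mul_le_mul_of_nonneg_right hr.le (sub_nonneg.2 hlt.le)
      have h2 : 0 ≤ 2 * I.step σ.scale * σ.x e := by positivity
      have h3 : 0 ≤ I.step σ.scale * σ.x e := by positivity
      have h4 := mul_nonneg hx0 hv0
      linarith
    · have h1 : - I.reducedWeight σ.p e * (σ.x e - y e) ≤
          (I.step σ.scale + I.violation σ.scale σ.p e) * (σ.x e - y e) :=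
        mul_le_mul_of_nonneg_right (by linarith) (sub_nonneg.2 hle)
      have h2 : 0 ≤ (I.step σ.scale + I.violation σ.scale σ.p e) * y e := by positivity
      have h3 : 0 ≤ 2 * I.step σ.scale * y e := by positivity
      linarith
  rw [weight_eq hI.source_ne_sink hy σ.p, weight_eq hI.source_ne_sink h.isFlow σ.p, h.p_source]
  linarith

/-- Either lower bound on `p_t` lets the negative term `-p_t * value x` absorb `δ * ∑ x`: the first
through `K`, the second through the depth. -/
theorem Invariant.nearOpt_of_le_p_sink [Fintype V] (hI : I.Admissible) {K b : ℝ}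
    (hK : ∀ x, I.net.IsFlow x → 0 ≤ I.weight x → I.wmin * ∑ e, x e ≤ K * I.net.value x)
    {y : E → ℝ} (hy : I.net.IsFlow y) (hy0 : 0 ≤ I.net.value y)
    {σ : ScalingState V E} (h : I.Invariant σ)
    (hp : I.tol * K ≤ σ.p I.net.sink ∨ I.tol * (I.net.depth * I.wmin) ≤ σ.p I.net.sink) :
    I.NearOpt b y σ := by
  intro hT hb
  have hη := hI.tol_pos
  have h1 := h.weight_le hI hy
  have h2 := h.totalViolation_le
  rw [if_neg (by rw [hT]; exact lt_irrefl _), add_zero] at h2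
  have h3 : I.step σ.scale * ∑ e, σ.x e ≤ σ.p I.net.sink * I.net.value σ.x := by
    rw [hT, hI.step_lastScale]
    rcases hp with hp | hp
    · have h4 := mul_le_mul_of_nonneg_left (hK _ h.isFlow (h.weight_nonneg hI)) hη.le
      have h5 := mul_le_mul_of_nonneg_right hp h.value_nonneg
      linarith
    · have h4 := mul_le_mul_of_nonneg_left (h.sum_le hI) (mul_pos hη hI.wmin_pos).le
      have h5 := mul_le_mul_of_nonneg_right hp h.value_nonneg
      linarith
  have h6 := mul_le_mul_of_nonneg_right hb hy0
  rw [hT] at h1 h3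
  linarith

theorem Admissible.invariant_init [Fintype V] (hI : I.Admissible) : I.Invariant I.init where
  scale_le := Nat.zero_le _
  isFlow := FlowNetwork.isFlow_zero hI.cap_nonneg
  value_nonneg := (FlowNetwork.value_zero _).ge
  p_source := by simp [init, hI.acyclic.level_source]
  unreachable e he := by
    refine ⟨rfl, ?_⟩
    have := hI.w_neg e he
    have := hI.wmax_pos
    simp only [init, reducedWeight, FlowNetwork.level_eq_zero he]
    have : 0 ≤ I.wmax * (I.net.level (I.net.tgt e) : ℝ) := by positivity
    simp only [Nat.cast_zero, mul_zero, add_zero]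
    linarith
  residual e _ := by
    refine lt_of_le_of_lt (b := 0) ?_ (by have := hI.step_pos (I.init).scale; positivity)
    have hw := hI.wmax_pos
    simp only [init, reducedWeight]
    by_cases he : ∃ n, I.net.Path I.net.source (I.net.src e) n
    · have h1 : (I.net.level (I.net.src e) : ℝ) + 1 ≤ I.net.level (I.net.tgt e) := by
        exact_mod_cast hI.acyclic.level_add_one_le he ⟨e, rfl, rfl⟩
      nlinarith [hI.w_le e]
    · have h1 := hI.w_neg e he
      have : 0 ≤ I.wmax * (I.net.level (I.net.tgt e) : ℝ) := by positivity
      rw [FlowNetwork.level_eq_zero he]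
      simp only [Nat.cast_zero, mul_zero, add_zero]
      linarith
  p_sink := by
    obtain ⟨k, hk⟩ := hI.exists_start_eq 0
    refine ⟨k, ?_⟩
    change I.wmax * (I.net.level I.net.sink : ℝ) = I.target 0 + k * I.step 0
    rw [← hk, FlowNetwork.depth]
    ring
  totalViolation_le := by
    simp [init, totalViolation, FlowNetwork.value_zero, weight_zero]

theorem Invariant.rescale [Fintype V] (hI : I.Admissible) {σ : ScalingState V E} (h : I.Invariant σ)
    (hσ : I.ScaleDone σ) (hT : σ.scale < I.lastScale) :
    I.Invariant
      { scale := σ.scale + 1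
        x := σ.x
        p := I.dualRescale σ.scale σ.p } where
  scale_le := hT
  isFlow := h.isFlow
  value_nonneg := h.value_nonneg
  p_source := by simp [dualRescale, h.p_source, hI.acyclic.level_source]
  unreachable e he := by
    refine ⟨(h.unreachable e he).1, ?_⟩
    have h1 := (h.unreachable e he).2
    have h2 : 0 ≤ I.step σ.scale * (I.net.level (I.net.tgt e) : ℝ) := by
      have := hI.step_pos σ.scale
      positivity
    simp only [reducedWeight_dualRescale, FlowNetwork.level_eq_zero he, Nat.cast_zero, sub_zero]
    linarith
  residual e he := by
    have hδ := hI.step_pos σ.scale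
    simp only [reducedWeight_dualRescale, step_succ]
    by_cases hr : ∃ n, I.net.Path I.net.source (I.net.src e) n
    · have h1 : (I.net.level (I.net.src e) : ℝ) + 1 ≤ I.net.level (I.net.tgt e) := by
        exact_mod_cast hI.acyclic.level_add_one_le hr ⟨e, rfl, rfl⟩
      have := h.residual e he
      nlinarith
    · have h1 := (h.unreachable e hr).2
      have h2 : 0 ≤ I.step σ.scale * (I.net.level (I.net.tgt e) : ℝ) := by positivity
      simp only [FlowNetwork.level_eq_zero hr, Nat.cast_zero, sub_zero]
      linarith
  p_sink := by
    rw [scaleDone_iff _ h.scale_le, target, if_pos hT] at hσ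
    obtain ⟨k, hk⟩ := hI.exists_start_eq (σ.scale + 1)
    -- The rescale raises the sink by `D` old steps, which are `2 * D` new ones.
    refine ⟨k + 2 * I.net.depth, ?_⟩
    simp only [dualRescale, hσ]
    push_cast
    rw [add_mul, ← add_assoc, ← hk, step_succ, FlowNetwork.depth]
    ring
  totalViolation_le := by
    have hδ := hI.step_pos σ.scale
    have h1 := h.totalViolation_le
    rw [if_pos hT] at h1
    have h2 := h.sum_level_diff_mul hI
    -- The reduced weight falls by `δ` times the level difference, and the allowance shrinks by a
    -- further `δ / 2`. As the difference is at least `1`, the loss is at most `3/2 * δ` times it.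
    have h3 : I.totalViolation
        { scale := σ.scale + 1, x := σ.x, p := I.dualRescale σ.scale σ.p } ≤
        I.totalViolation σ + 3 / 2 * I.step σ.scale * (I.net.depth * I.net.value σ.x) := by
      rw [← h2, Finset.mul_sum, totalViolation, totalViolation, ← Finset.sum_add_distrib]
      refine Finset.sum_le_sum fun e _ => ?_
      rcases (h.isFlow.nonneg e).eq_or_lt with he | he
      · simp [← he]
      have hl := h.level_src_add_one_le hI he.ne'
      have h4 : I.violation (σ.scale + 1) (I.dualRescale σ.scale σ.p) e ≤
          I.violation σ.scale σ.p e + 3 / 2 * I.step σ.scale *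
            ((I.net.level (I.net.tgt e) : ℝ) - I.net.level (I.net.src e)) := by
        have hv0 := I.violation_nonneg σ.scale σ.p e
        have hv : - I.reducedWeight σ.p e - I.step σ.scale ≤ I.violation σ.scale σ.p e :=
          le_max_right _ _
        refine max_le ?_ ?_
        · have : 0 ≤ 3 / 2 * I.step σ.scale *
            ((I.net.level (I.net.tgt e) : ℝ) - I.net.level (I.net.src e)) :=
            mul_nonneg (by positivity) (by linarith)
          linarith
        · rw [reducedWeight_dualRescale, step_succ]
          nlinarith
      have h5 := mul_le_mul_of_nonneg_left h4 he.le
      simp only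
      linarith
    have h4 : 0 ≤ 3 / 2 * I.step σ.scale * (I.net.depth * I.net.value σ.x) := by
      have := h.value_nonneg
      positivity
    simp only [step_succ]
    split_ifs <;> linarith

theorem Invariant.tol_mul_le_p_sink_rescale (hI : I.Admissible) {σ : ScalingState V E}
    (hη : I.tol ≤ 1) (h : I.Invariant σ)
    (hσ : I.ScaleDone σ) (hT : σ.scale + 1 = I.lastScale) :
    I.tol * (I.net.depth * I.wmin) ≤ I.dualRescale σ.scale σ.p I.net.sink := by
  rw [scaleDone_iff _ h.scale_le, target, if_pos (by omega), hT, hI.wmax_eq] at hσ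
  have h1 := hI.wmin_pos
  have h2 : 0 ≤ I.step σ.scale * (I.net.level I.net.sink : ℝ) := by
    have := hI.step_pos σ.scale
    positivity
  have h3 : I.tol * (I.net.depth * I.wmin) ≤ I.net.depth * I.wmin :=
    mul_le_of_le_one_left (by positivity) hη
  have h4 : (I.net.depth : ℝ) * (2 ^ I.lastScale * I.wmin) / 2 ^ I.lastScale =
      I.net.depth * I.wmin := by field_simp
  rw [dualRescale, hσ, h4]
  linarith

theorem Invariant.exists_succ_of_not_scaleDone {σ : ScalingState V E} (h : I.Invariant σ)
    (hσ : ¬ I.ScaleDone σ) :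
    ∃ k : ℕ, σ.p I.net.sink = I.target σ.scale + (k + 1) * I.step σ.scale := by
  obtain ⟨_ | k, hk⟩ := h.p_sink
  · rw [scaleDone_iff _ h.scale_le, hk] at hσ
    simp at hσ
  · exact ⟨k, by rw [hk]; push_cast; ring⟩

theorem Invariant.p_sink_nonneg (hI : I.Admissible) {σ : ScalingState V E} (h : I.Invariant σ) :
    0 ≤ σ.p I.net.sink := by
  obtain ⟨k, hk⟩ := h.p_sink
  have := hI.step_pos σ.scale
  have := hI.target_nonneg σ.scale
  rw [hk]; positivity

theorem Invariant.dualAdjust_sink (hI : I.Admissible) {σ : ScalingState V E} {z : E ⊕ E → ℝ}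
    (hz : (I.eligible σ.scale σ.x σ.p).IsBlockingFlow z) :
    I.dualAdjust σ.scale (augment σ.x z) σ.p I.net.sink =
      σ.p I.net.sink - I.step σ.scale :=
  if_neg (not_reachable_sink_of_isBlockingFlow (hI.step_pos _) hz)

theorem Invariant.weight_augment_ge [Fintype V] (hI : I.Admissible) {σ : ScalingState V E}
    (h : I.Invariant σ) {z : E ⊕ E → ℝ}
    (hz : (I.eligible σ.scale σ.x σ.p).IsBlockingFlow z) :
    I.weight σ.x ≤ I.weight (augment σ.x z) := by
  have h1 := ScalingInput.weight_augment_ge hI.source_ne_sink (hI.step_pos σ.scale)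
    h.p_source hz.isFlow
  have h2 := mul_nonneg (h.p_sink_nonneg hI) hz.value_nonneg
  linarith

theorem Invariant.augment_eq_zero (hI : I.Admissible) {σ : ScalingState V E} (h : I.Invariant σ)
    {z : E ⊕ E → ℝ} (hz : (I.eligible σ.scale σ.x σ.p).IsFlow z) {e : E}
    (he : ¬ ∃ n, I.net.Path I.net.source (I.net.src e) n) : augment σ.x z e = 0 := by
  obtain ⟨h0, hw⟩ := h.unreachable e he
  have h1 := isFlow_eligible_inl hz e (hw.trans (hI.step_pos _))
  have h2 := isFlow_eligible_inr_le h.isFlow hz e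
  have h3 := hz.nonneg (Sum.inr e)
  rw [augment]; linarith

/-- If the reduced weight is nonpositive, no flow is added, and an edge still carrying flow has an
eligible backward arc, so its reduced weight does not fall. If it is positive, one adjustment cannot
take it below `-δ`. -/
theorem Invariant.totalViolation_iterate_le (hI : I.Admissible) {σ : ScalingState V E}
    (h : I.Invariant σ) {z : E ⊕ E → ℝ} (hz : (I.eligible σ.scale σ.x σ.p).IsFlow z) :
    I.totalViolation
      { scale := σ.scale
        x := augment σ.x z
        p := I.dualAdjust σ.scale (augment σ.x z) σ.p } ≤ I.totalViolation σ := by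
  have hδ := hI.step_pos σ.scale
  refine Finset.sum_le_sum fun e _ => ?_
  have hx' := (isFlow_augment h.isFlow hz).nonneg e
  simp only
  rcases hx'.eq_or_lt with h0 | h0
  · rw [← h0, zero_mul]
    exact mul_nonneg (h.isFlow.nonneg e) (I.violation_nonneg _ _ e)
  rcases le_or_gt (I.reducedWeight σ.p e) 0 with hw | hw
  · have h1 := isFlow_eligible_inl hz e (hw.trans_lt hδ)
    have h2 := hz.nonneg (Sum.inr e)
    refine mul_le_mul (by rw [augment]; linarith) (I.violation_le_of_le _ ?_)
      (I.violation_nonneg _ _ e) (h.isFlow.nonneg e)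
    exact le_reducedWeight_dualAdjust hδ _ _ e fun hr => reachable_src hr hw h0
  · have h1 : I.violation σ.scale (I.dualAdjust σ.scale (augment σ.x z) σ.p) e = 0 := by
      have := (abs_le.1 (abs_reducedWeight_dualAdjust_sub hδ (augment σ.x z) σ.p e)).1
      exact max_eq_left (by linarith)
    rw [h1, mul_zero]
    exact mul_nonneg (h.isFlow.nonneg e) (I.violation_nonneg _ _ e)

theorem Invariant.iterate [Fintype V] (hI : I.Admissible) {σ : ScalingState V E} (h : I.Invariant σ)
    (hσ : ¬ I.ScaleDone σ) {z : E ⊕ E → ℝ}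
    (hz : (I.eligible σ.scale σ.x σ.p).IsBlockingFlow z) :
    I.Invariant
      { scale := σ.scale
        x := augment σ.x z
        p := I.dualAdjust σ.scale (augment σ.x z) σ.p } where
  scale_le := h.scale_le
  isFlow := isFlow_augment h.isFlow hz.isFlow
  value_nonneg := by
    simp only
    rw [value_augment σ.scale σ.x σ.p]
    exact add_nonneg h.value_nonneg hz.value_nonneg
  p_source := by
    simp only
    rw [dualAdjust, if_pos (reachable_source _ _ _), h.p_source]
  unreachable e he := by
    refine ⟨h.augment_eq_zero hI hz.isFlow he, ?_⟩
    refine (reducedWeight_dualAdjust_le (hI.step_pos _) _ _ e fun hr => ?_).trans_lt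
      (h.unreachable e he).2
    exact absurd (exists_path_of_reachable
      (fun e he => h.augment_eq_zero hI hz.isFlow he) hr) he
  residual e he := by
    have hδ := hI.step_pos σ.scale
    have h1 : I.reducedWeight σ.p e < 2 * I.step σ.scale := by
      by_cases hx : (σ.x e : EReal) < I.net.cap e
      · exact h.residual e hx
      · by_contra hc
        -- A saturated edge of large reduced weight has no eligible backward arc, so it stays
        -- saturated.
        have hr := isFlow_eligible_inr hz.isFlow e (by linarith)
        have hl := hz.isFlow.nonneg (Sum.inl e)
        refine hx (lt_of_le_of_lt ?_ he)
        simp only [augment]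
        exact_mod_cast (by linarith)
    by_cases hw : I.step σ.scale ≤ I.reducedWeight σ.p e
    · exact (reducedWeight_dualAdjust_le hδ _ _ e fun hr => reachable_tgt hr hw he).trans_lt h1
    · have := (abs_le.1 (abs_reducedWeight_dualAdjust_sub hδ (augment σ.x z) σ.p e)).2
      simp only
      linarith
  p_sink := by
    obtain ⟨k, hk⟩ := h.exists_succ_of_not_scaleDone hσ
    refine ⟨k, ?_⟩
    simp only
    rw [Invariant.dualAdjust_sink hI hz, hk]
    ring
  totalViolation_le := by
    have h1 := h.totalViolation_iterate_le hI hz.isFlow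
    have h2 := h.totalViolation_le
    have h3 := ScalingInput.weight_augment_ge hI.source_ne_sink (hI.step_pos σ.scale)
      h.p_source hz.isFlow
    have hη := hI.tol_pos
    simp only
    rw [value_augment σ.scale σ.x σ.p]
    split_ifs with hT
    · rw [if_pos hT] at h2
      have h4 : I.net.depth * I.step σ.scale ≤ 2 * I.tol * σ.p I.net.sink := by
        obtain ⟨k, hk⟩ := h.p_sink
        have hδ := hI.step_pos σ.scale
        have h5 : I.target σ.scale ≤ σ.p I.net.sink := by
          rw [hk]
          have : 0 ≤ (k : ℝ) * I.step σ.scale := by positivity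
          linarith
        have h6 : I.net.depth * I.step σ.scale = 2 * I.tol * I.target σ.scale := by
          rw [target, if_pos hT, step, pow_succ]
          field_simp
        rw [h6]
        exact mul_le_mul_of_nonneg_left h5 (by positivity)
      have h5 := mul_le_mul_of_nonneg_right h4 hz.value_nonneg
      have h6 := mul_le_mul_of_nonneg_left h3 (by positivity : 0 ≤ 6 * I.tol)
      linarith
    · rw [if_neg hT] at h2
      have h4 := mul_le_mul_of_nonneg_left (h.weight_augment_ge hI hz)
        (by positivity : 0 ≤ 6 * I.tol)
      linarith

theorem Invariant.step [Fintype V] (hI : I.Admissible) {σ τ : ScalingState V E} (h : I.Invariant σ)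
    (hστ : I.Step σ τ) : I.Invariant τ := by
  cases hστ with
  | iterate z hσ hz => exact h.iterate hI hσ hz
  | rescale hσ hT => exact h.rescale hI hσ hT

/-- The bound `b` exceeds `η * K` by one step, so the iteration that first brings `p_t` down to `b`
cannot overshoot `η * K`; the comparison is made there. Later iterations only increase the weight.
If the last scale already starts below `b`, the depth bound applies at its start. -/
theorem Invariant.nearOpt_step [Fintype V] (hI : I.Admissible) (hη : I.tol ≤ 1) {K : ℝ}
    (hK : ∀ x, I.net.IsFlow x → 0 ≤ I.weight x → I.wmin * ∑ e, x e ≤ K * I.net.value x)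
    {y : E → ℝ} (hy : I.net.IsFlow y) (hy0 : 0 ≤ I.net.value y)
    {σ τ : ScalingState V E} (h : I.Invariant σ)
    (hn : I.NearOpt (I.tol * K + I.step I.lastScale) y σ) (hστ : I.Step σ τ) :
    I.NearOpt (I.tol * K + I.step I.lastScale) y τ := by
  have hτ := h.step hI hστ
  cases hστ with
  | iterate z hσ hz =>
    rcases le_or_gt (σ.p I.net.sink) (I.tol * K + I.step I.lastScale) with hp | hp
    · intro hT _
      have h1 := hn hT hp
      have h2 := h.weight_augment_ge hI hz
      have h3 := hI.tol_pos
      have h4 := mul_le_mul_of_nonneg_left h2 (by positivity : 0 ≤ 1 + 6 * I.tol)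
      simp only
      linarith
    · intro hT
      refine hτ.nearOpt_of_le_p_sink hI hK hy hy0 (Or.inl ?_) hT
      simp only at hT ⊢
      rw [Invariant.dualAdjust_sink hI hz, hT]
      linarith
  | rescale hσ hT =>
    intro hT'
    exact hτ.nearOpt_of_le_p_sink hI hK hy hy0
      (Or.inr (h.tol_mul_le_p_sink_rescale hI hη hσ hT')) hT'

theorem Admissible.invariant_of_reflTransGen [Fintype V] (hI : I.Admissible) {σ : ScalingState V E}
    (h : Relation.ReflTransGen I.Step I.init σ) : I.Invariant σ := by
  induction h with
  | refl => exact hI.invariant_init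
  | tail _ hστ ih => exact ih.step hI hστ

theorem Admissible.nearOpt_of_reflTransGen [Fintype V] (hI : I.Admissible) (hη : I.tol ≤ 1) {K : ℝ}
    (hK : ∀ x, I.net.IsFlow x → 0 ≤ I.weight x → I.wmin * ∑ e, x e ≤ K * I.net.value x)
    {y : E → ℝ} (hy : I.net.IsFlow y) (hy0 : 0 ≤ I.net.value y) {σ : ScalingState V E}
    (h : Relation.ReflTransGen I.Step I.init σ) :
    I.NearOpt (I.tol * K + I.step I.lastScale) y σ := by
  induction h with
  | refl =>
    intro hT
    exact hI.invariant_init.nearOpt_of_le_p_sink hI hK hy hy0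
      (Or.inr (hI.tol_mul_le_p_sink_init hT.symm hη)) hT
  | tail hσ hστ ih => exact (hI.invariant_of_reflTransGen hσ).nearOpt_step hI hη hK hy hy0 ih hστ

/-! ### Termination -/

theorem Invariant.halts_of_iterate [Fintype V] (hI : I.Admissible) {σ : ScalingState V E}
    (h : I.Invariant σ) {k : ℕ}
    (hk : σ.p I.net.sink = I.target σ.scale + (k + 1 : ℕ) * I.step σ.scale)
    (ih : ∀ τ, I.Invariant τ → τ.scale = σ.scale →
      τ.p I.net.sink = I.target σ.scale + k * I.step σ.scale → I.Halts τ) : I.Halts σ := by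
  have hσ : ¬ I.ScaleDone σ := by
    rw [scaleDone_iff _ h.scale_le, hk]
    have := hI.step_pos σ.scale
    have : 0 < ((k + 1 : ℕ) : ℝ) * I.step σ.scale := by positivity
    linarith
  obtain ⟨z, hz⟩ := hI.exists_blockingFlow (i := σ.scale) (p := σ.p) h.isFlow
  refine .step σ ⟨_, .iterate σ z hσ hz⟩ fun τ hτ => ?_
  have hinv := h.step hI hτ
  cases hτ with
  | iterate z _ hz =>
    refine ih _ hinv rfl ?_
    simp only
    rw [Invariant.dualAdjust_sink hI hz, hk]
    push_cast
    ring
  | rescale hσ' _ => exact absurd hσ' hσ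

/-- Lexicographic induction on the number of remaining scales and the number of steps the sink still
has to fall. -/
theorem Invariant.halts [Fintype V] (hI : I.Admissible) {σ : ScalingState V E} (h : I.Invariant σ) :
    I.Halts σ := by
  suffices H : ∀ (n k : ℕ) (σ : ScalingState V E), I.Invariant σ →
      I.lastScale - σ.scale = n →
      σ.p I.net.sink = I.target σ.scale + k * I.step σ.scale → I.Halts σ by
    obtain ⟨k, hk⟩ := h.p_sink
    exact H _ k σ h rfl hk
  intro n
  induction n with
  | zero =>
    intro k
    induction k with
    | zero =>
      intro σ h hn hk
      have hT : σ.scale = I.lastScale := by have := h.scale_le; omega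
      exact .final σ ⟨hT, (scaleDone_iff _ h.scale_le).2 (by rw [hk]; simp)⟩
    | succ k ih =>
      intro σ h hn hk
      exact h.halts_of_iterate hI hk fun τ hτ hs hp => ih τ hτ (by rw [hs, hn]) (by rw [hp, hs])
  | succ n ihn =>
    intro k
    induction k with
    | zero =>
      intro σ h hn hk
      have hσ : I.ScaleDone σ := (scaleDone_iff _ h.scale_le).2 (by rw [hk]; simp)
      refine .step σ ⟨_, .rescale σ hσ (by omega)⟩ fun τ hτ => ?_
      have hinv := h.step hI hτ
      cases hτ with
      | iterate z hσ' _ => exact absurd hσ hσ'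
      | rescale _ hT =>
        obtain ⟨k, hk⟩ := hinv.p_sink
        exact ihn k _ hinv (by simp only; omega) hk
    | succ k ih =>
      intro σ h hn hk
      exact h.halts_of_iterate hI hk fun τ hτ hs hp => ih τ hτ (by rw [hs, hn]) (by rw [hp, hs])

end ScalingInput

/-! ### The degenerate case of depth zero -/

namespace ScalingInput

variable {V E : Type*} {I : ScalingInput V E}

theorem scaleDone_of_depth_eq_zero (hD : I.net.depth = 0) {σ : ScalingState V E}
    (hs : σ.scale ≤ I.lastScale) (hp : σ.p I.net.sink = 0) : I.ScaleDone σ := by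
  rw [scaleDone_iff _ hs, hp, target, hD]
  simp

theorem init_p_sink_of_depth_eq_zero (hD : I.net.depth = 0) : I.init.p I.net.sink = 0 := by
  rw [FlowNetwork.depth] at hD
  simp [init, hD]

variable [Fintype E]

/-- If the sink cannot be reached from the source, then the flow remains zero. -/
theorem step_of_depth_eq_zero (hD : I.net.depth = 0) {σ τ : ScalingState V E}
    (hs : σ.scale ≤ I.lastScale) (hp : σ.p I.net.sink = 0) (h : I.Step σ τ) :
    τ.scale = σ.scale + 1 ∧ τ.scale ≤ I.lastScale ∧ τ.p I.net.sink = 0 ∧ τ.x = σ.x := by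
  cases h with
  | iterate z hσ _ => exact absurd (scaleDone_of_depth_eq_zero hD hs hp) hσ
  | rescale hσ hT =>
    refine ⟨rfl, hT, ?_, rfl⟩
    rw [FlowNetwork.depth] at hD
    simp [dualRescale, hp, hD]

theorem halts_init_of_depth_eq_zero (hD : I.net.depth = 0) : I.Halts I.init := by
  suffices H : ∀ (n : ℕ) (σ : ScalingState V E), σ.scale ≤ I.lastScale →
      σ.p I.net.sink = 0 → I.lastScale - σ.scale = n → I.Halts σ from
    H _ _ (Nat.zero_le _) (init_p_sink_of_depth_eq_zero hD) rfl
  intro n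
  induction n with
  | zero =>
    intro σ hs hp hn
    exact .final σ ⟨by omega, scaleDone_of_depth_eq_zero hD hs hp⟩
  | succ n ih =>
    intro σ hs hp hn
    refine .step σ ⟨_, .rescale σ (scaleDone_of_depth_eq_zero hD hs hp) (by omega)⟩ fun τ hτ => ?_
    obtain ⟨h1, h2, h3, -⟩ := step_of_depth_eq_zero hD hs hp hτ
    exact ih τ h2 h3 (by omega)

theorem eq_zero_of_returns_of_depth_eq_zero (hD : I.net.depth = 0) {x : E → ℝ}
    (h : I.Returns x) : x = fun _ => 0 := by
  obtain ⟨σ, hσ, -, rfl⟩ := h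
  suffices H : σ.scale ≤ I.lastScale ∧ σ.p I.net.sink = 0 ∧ σ.x = fun _ => 0 from H.2.2
  induction hσ with
  | refl => exact ⟨Nat.zero_le _, init_p_sink_of_depth_eq_zero hD, rfl⟩
  | tail _ hτ ih =>
    obtain ⟨-, h2, h3, h4⟩ := step_of_depth_eq_zero hD ih.1 ih.2.1 hτ
    exact ⟨h2, h3, h4.trans ih.2.2⟩

end ScalingInput

/-! ### The min-cost flow instance -/

section MinCost

variable {V E : Type*} (G : FlowNetwork V E) (q : E → ℝ) (Q wmin wmax tol : ℝ)

theorem lastScale_minCostInput {T : ℕ} (h : wmax / wmin = 2 ^ T) :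
    (minCostInput G q Q wmin wmax tol).lastScale = T := by
  change ⌊Real.logb 2 (wmax / wmin)⌋₊ = T
  rw [h, Real.logb_pow, Real.logb_self_eq_one one_lt_two, mul_one, Nat.floor_natCast]

theorem acyclic_minCostInput (hG : G.Acyclic) :
    (minCostInput G q Q wmin wmax tol).net.Acyclic := by
  have hnone : ∀ b, ¬ (minCostInput G q Q wmin wmax tol).net.Adj none b := by
    rintro b ⟨_ | e, h, -⟩ <;> exact Option.some_ne_none _ h
  have key : ∀ a b, Relation.TransGen (minCostInput G q Q wmin wmax tol).net.Adj a b →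
      ∀ v, b = some v → ∃ u, a = some u ∧ Relation.TransGen G.Adj u v := by
    intro a b h
    induction h using Relation.TransGen.head_induction_on with
    | single h =>
      rintro v rfl
      obtain ⟨_ | e, h1, h2⟩ := h
      · exact absurd h2.symm (Option.some_ne_none _)
      · exact ⟨_, h1.symm, .single ⟨e, rfl, Option.some_injective _ h2⟩⟩
    | head h _ ih =>
      intro v hv
      obtain ⟨u, rfl, hu⟩ := ih v hv
      obtain ⟨_ | e, h1, h2⟩ := h
      · exact absurd h2.symm (Option.some_ne_none _)
      · exact ⟨_, h1.symm, .head ⟨e, rfl, Option.some_injective _ h2⟩ hu⟩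
  rintro (_ | v) h
  · obtain ⟨b, hb, -⟩ := Relation.TransGen.head'_iff.1 h
    exact hnone b hb
  · obtain ⟨u, hu, h'⟩ := key _ _ h v rfl
    obtain rfl := Option.some_injective _ hu
    exact hG _ h'

theorem path_sink_of_path_none
    (h : ∃ n, (minCostInput G q Q wmin wmax tol).net.Path (some G.source) none n) :
    ∃ n, (minCostInput G q Q wmin wmax tol).net.Path (some G.source) (some G.sink) n := by
  obtain ⟨n, hn⟩ := h
  cases hn with
  | snoc hp hadj =>
    obtain ⟨_ | e, h1, h2⟩ := hadj
    · exact ⟨_, h1 ▸ hp⟩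
    · exact absurd h2 (Option.some_ne_none _)

theorem admissible_minCostInput {G : FlowNetwork V E}
    (hG : G.Acyclic) (hst : G.source ≠ G.sink)
    (hcap : ∀ e, 0 ≤ G.cap e ∧ G.cap e < ⊤)
    {q : E → ℝ} {Q wmin wmax tol : ℝ} (hwmin : 0 < wmin)
    (hq : ∀ e, wmin ≤ q e ∧ q e ≤ wmax) (hQ : wmin ≤ Q ∧ Q ≤ wmax)
    (hratio : ∃ T : ℕ, wmax / wmin = 2 ^ T)
    (htol : ∃ k : ℕ, tol = (1 / 2) ^ k) (htol' : tol < 1 / 10)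
    (hsink : ∃ n, (minCostInput G q Q wmin wmax tol).net.Path (some G.source) none n) :
    (minCostInput G q Q wmin wmax tol).Admissible where
  acyclic := acyclic_minCostInput G q Q wmin wmax tol hG
  source_ne_sink := Option.some_ne_none _
  cap_nonneg e := by
    cases e with
    | none => exact le_top
    | some e => exact (hcap e).1
  no_top_path h := by
    suffices H : ∀ b, Relation.ReflTransGen
        (fun a b => ∃ e, (minCostInput G q Q wmin wmax tol).net.src e = a ∧
          (minCostInput G q Q wmin wmax tol).net.tgt e = b ∧
          (minCostInput G q Q wmin wmax tol).net.cap e = ⊤) (some G.source) b →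
        b = some G.source from absurd (H _ h).symm (Option.some_ne_none _)
    intro b hb
    induction hb with
    | refl => rfl
    | tail _ h ih =>
      obtain ⟨_ | e, h1, -, h3⟩ := h
      · rw [ih] at h1
        exact absurd (Option.some_injective _ h1).symm hst
      · exact absurd h3 (hcap e).2.ne
  sink_reachable := hsink
  wmin_pos := hwmin
  wmax_eq := by
    obtain ⟨T, hT⟩ := hratio
    rw [lastScale_minCostInput G q Q wmin wmax tol hT, ← hT]
    exact (div_mul_cancel₀ _ hwmin.ne').symm
  w_le e := by
    cases e with
    | none => exact hQ.2
    | some e =>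
      change - q e ≤ wmax
      linarith [hq e]
  w_neg e he := by
    cases e with
    | none => exact absurd (path_sink_of_path_none G q Q wmin wmax tol hsink) he
    | some e =>
      change - q e < 0
      linarith [hq e]
  tol_eq := by
    obtain ⟨_ | k, hk⟩ := htol
    · norm_num [hk] at htol'
    · exact ⟨k, hk⟩

variable [Fintype E]

theorem inflow_minCostInput_some (x : Option E → ℝ) (v : V) :
    (minCostInput G q Q wmin wmax tol).net.inflow x (some v) =
      G.inflow (fun e => x (some e)) v := by
  classical
  simp [FlowNetwork.inflow_eq_sum_ite, Fintype.sum_option, minCostInput]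

open Classical in
theorem outflow_minCostInput_some (x : Option E → ℝ) (v : V) :
    (minCostInput G q Q wmin wmax tol).net.outflow x (some v) =
      (if G.sink = v then x none else 0) + G.outflow (fun e => x (some e)) v := by
  simp [FlowNetwork.outflow_eq_sum_ite, Fintype.sum_option, minCostInput]

theorem value_minCostInput (hst : G.source ≠ G.sink) (x : Option E → ℝ) :
    (minCostInput G q Q wmin wmax tol).net.value x = G.value (fun e => x (some e)) := by
  change _ - _ = _ - _
  change (minCostInput G q Q wmin wmax tol).net.outflow x (some G.source) -
    (minCostInput G q Q wmin wmax tol).net.inflow x (some G.source) = _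
  rw [inflow_minCostInput_some, outflow_minCostInput_some, if_neg hst.symm, zero_add]

theorem weight_minCostInput (x : Option E → ℝ) :
    (minCostInput G q Q wmin wmax tol).weight x = Q * x none - ∑ e, q e * x (some e) := by
  simp [ScalingInput.weight, Fintype.sum_option, minCostInput, sub_eq_add_neg]

variable {G q Q wmin wmax tol}

theorem isFlow_of_isFlow_minCostInput {x : Option E → ℝ}
    (hx : (minCostInput G q Q wmin wmax tol).net.IsFlow x) :
    G.IsFlow (fun e => x (some e)) where
  nonneg e := hx.nonneg (some e)
  le_cap e := hx.le_cap (some e)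
  conserve v hs ht := by
    have h := hx.conserve (some v) (fun h => hs (Option.some_injective _ h))
      (Option.some_ne_none _)
    rwa [inflow_minCostInput_some, outflow_minCostInput_some, if_neg ht.symm, zero_add] at h

theorem value_eq_of_isFlow_minCostInput [Fintype V] (hst : G.source ≠ G.sink) {x : Option E → ℝ}
    (hx : (minCostInput G q Q wmin wmax tol).net.IsFlow x) :
    G.value (fun e => x (some e)) = x none := by
  have h := hx.conserve (some G.sink) (fun h => hst (Option.some_injective _ h).symm)
    (Option.some_ne_none _)
  rw [inflow_minCostInput_some, outflow_minCostInput_some, if_pos rfl] at h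
  rw [← (isFlow_of_isFlow_minCostInput hx).inflow_sink_sub_outflow_sink hst, h]
  ring

theorem isFlow_minCostInput [Fintype V] (hst : G.source ≠ G.sink) {y : E → ℝ}
    (hy : G.IsFlow y) (hy0 : 0 ≤ G.value y) :
    (minCostInput G q Q wmin wmax tol).net.IsFlow (fun e => e.elim (G.value y) y) where
  nonneg e := by
    cases e with
    | none => exact hy0
    | some e => exact hy.nonneg e
  le_cap e := by
    cases e with
    | none => exact le_top
    | some e => exact hy.le_cap e
  conserve v hs ht := by
    cases v with
    | none => exact absurd rfl ht
    | some v =>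
      rw [inflow_minCostInput_some, outflow_minCostInput_some]
      split_ifs with hv
      · rw [← hv]
        simp only [Option.elim]
        linarith [hy.inflow_sink_sub_outflow_sink hst]
      · rw [zero_add]
        exact hy.conserve v (fun h => hs (congrArg some h)) fun h => hv h.symm

/-- No edge leaves the set of vertices reachable from the source; summing conservation against its
indicator leaves only flow entering it. -/
theorem value_nonpos_of_not_path [Fintype V] (hst : G.source ≠ G.sink)
    (h : ¬ ∃ n, (minCostInput G q Q wmin wmax tol).net.Path (some G.source) none n)
    {y : E → ℝ} (hy : G.IsFlow y) : G.value y ≤ 0 := by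
  classical
  set N := (minCostInput G q Q wmin wmax tol).net
  set p : V → ℝ := fun v => if ∃ n, N.Path (some G.source) (some v) n then 1 else 0 with hp
  have h1 := hy.sum_potential_diff_mul hst p
  have hs : p G.source = 1 := if_pos ⟨0, .nil⟩
  have ht : p G.sink = 0 := if_neg fun ⟨n, hn⟩ => h ⟨n + 1, hn.snoc ⟨none, rfl, rfl⟩⟩
  have h2 : 0 ≤ ∑ e, (p (G.tgt e) - p (G.src e)) * y e := by
    refine Finset.sum_nonneg fun e _ => mul_nonneg ?_ (hy.nonneg e)
    simp only [hp]
    split_ifs with h3 h4 h4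
    · simp
    · simp
    · obtain ⟨n, hn⟩ := h4
      exact absurd ⟨n + 1, hn.snoc ⟨some e, rfl, rfl⟩⟩ h3
    · simp
  rw [h1, hs, ht] at h2
  linarith

/-- Supplies `K`: nonnegative weight bounds the edge costs by `Q * f`, and the added edge
contributes `wmin * f`. -/
theorem wmin_mul_sum_le_minCostInput [Fintype V] (hst : G.source ≠ G.sink)
    (hq : ∀ e, wmin ≤ q e) (x : Option E → ℝ)
    (hx : (minCostInput G q Q wmin wmax tol).net.IsFlow x)
    (hw : 0 ≤ (minCostInput G q Q wmin wmax tol).weight x) :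
    wmin * ∑ e, x e ≤ (Q + wmin) * (minCostInput G q Q wmin wmax tol).net.value x := by
  rw [weight_minCostInput] at hw
  rw [value_minCostInput _ _ _ _ _ _ hst, value_eq_of_isFlow_minCostInput hst hx,
    Fintype.sum_option]
  have : wmin * ∑ e, x (some e) ≤ ∑ e, q e * x (some e) := by
    rw [Finset.mul_sum]
    exact Finset.sum_le_sum fun e _ => mul_le_mul_of_nonneg_right (hq e) (hx.nonneg _)
  linarith

/-- An optimal solution is no worse than the zero flow, so its value is nonnegative. -/
theorem value_nonneg_of_isMinCostFlow (hcap : ∀ e, 0 ≤ G.cap e) (hq : ∀ e, 0 ≤ q e)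
    (hQ : 0 < Q) {y : E → ℝ} (hy : G.IsMinCostFlow q Q y) : 0 ≤ G.value y := by
  have h := hy.2 _ (FlowNetwork.isFlow_zero hcap)
  have h0 : 0 ≤ ∑ e, q e * y e :=
    Finset.sum_nonneg fun e _ => mul_nonneg (hq e) (hy.1.nonneg e)
  simp only [FlowNetwork.cost, FlowNetwork.value_zero, mul_zero, Finset.sum_const_zero,
    sub_zero] at h
  exact nonneg_of_mul_nonneg_right (by linarith : 0 ≤ Q * G.value y) hQ

end MinCost

/-! ### Conclusion -/

theorem mainTheorem5 {V E : Type*} [Fintype V] [Fintype E] (G : FlowNetwork V E)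
    (hG : G.Acyclic) (hst : G.source ≠ G.sink)
    (hcap : ∀ e, 0 ≤ G.cap e ∧ G.cap e < ⊤)
    (q : E → ℝ) (Q wmin wmax tol ε : ℝ) (hwmin : 0 < wmin)
    (hq : ∀ e, wmin ≤ q e ∧ q e ≤ wmax) (hQ : wmin ≤ Q ∧ Q ≤ wmax)
    (hratio : ∃ T : ℕ, wmax / wmin = 2 ^ T)
    (htol : ∃ k : ℕ, tol = (1 / 2) ^ k) (htol' : tol < 1 / 10) (hε : tol ≤ ε / 8) :
    (minCostInput G q Q wmin wmax tol).Halts (minCostInput G q Q wmin wmax tol).init ∧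
    ∀ (x : E → ℝ) (f : ℝ),
      (minCostInput G q Q wmin wmax tol).Returns (fun e => e.elim f x) →
      G.IsFlow x ∧ G.value x = f ∧
      ∀ (xopt : E → ℝ) (fopt : ℝ), G.IsMinCostFlow q Q xopt → fopt = G.value xopt →
        ∑ e, q e * x e - Q * f ≤
          (1 + ε) * (∑ e, q e * xopt e - Q * fopt) + 2 * ε * Q * fopt := by
  have hη : 0 < tol := by obtain ⟨k, rfl⟩ := htol; positivity
  have hQ0 : 0 < Q := hwmin.trans_le hQ.1
  have hq0 : ∀ e, 0 ≤ q e := fun e => hwmin.le.trans (hq e).1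
  by_cases hsink : ∃ n, (minCostInput G q Q wmin wmax tol).net.Path (some G.source) none n
  · have hI := admissible_minCostInput hG hst hcap hwmin hq hQ hratio htol htol' hsink
    refine ⟨hI.invariant_init.halts hI, ?_⟩
    rintro x f ⟨σ, hσ, ⟨hT, hdone⟩, hx⟩
    have hinv := hI.invariant_of_reflTransGen hσ
    have hX := hinv.isFlow
    rw [hx] at hX
    have hxflow : G.IsFlow x := isFlow_of_isFlow_minCostInput hX
    have hxval : G.value x = f := value_eq_of_isFlow_minCostInput hst hX
    refine ⟨hxflow, hxval, ?_⟩
    rintro y _ hy rfl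
    have hy0 := value_nonneg_of_isMinCostFlow (fun e => (hcap e).1) hq0 hQ0 hy
    have hval := value_minCostInput G q Q wmin wmax tol hst (fun e => e.elim (G.value y) y)
    have hb := hI.nearOpt_of_reflTransGen (htol'.le.trans (by norm_num))
      (wmin_mul_sum_le_minCostInput hst fun e => (hq e).1)
      (isFlow_minCostInput hst hy.1 hy0) (by rw [hval]; exact hy0) hσ hT (by
        rw [(ScalingInput.scaleDone_iff _ hinv.scale_le).1 hdone, hT, ScalingInput.target,
          if_neg (lt_irrefl _)]
        have := hI.step_pos (minCostInput G q Q wmin wmax tol).lastScale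
        have : 0 ≤ tol * (Q + wmin) := by positivity
        change 0 ≤ tol * (Q + wmin) + _
        linarith)
    rw [hI.step_lastScale, hx, hval, weight_minCostInput, weight_minCostInput,
      Fintype.sum_option] at hb
    change Q * G.value y - ∑ e, q e * y e ≤ (1 + 6 * tol) * (Q * f - ∑ e, q e * x e) +
      2 * (tol * wmin) * (G.value y + ∑ e, y e) +
        (tol * (Q + wmin) + tol * wmin) * G.value y at hb
    have hopt := hy.2 x hxflow
    rw [FlowNetwork.cost, FlowNetwork.cost, hxval] at hopt
    have hS : wmin * ∑ e, y e ≤ ∑ e, q e * y e := by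
      rw [Finset.mul_sum]
      exact Finset.sum_le_sum fun e _ =>
        mul_le_mul_of_nonneg_right (hq e).1 (hy.1.nonneg e)
    -- With `S` the edge cost of `y`, this bounds the additive errors by `6η * S + η * Q * f*`.
    -- Optimality of `y` bounds the `6η` multiple of the returned weight by `6η * (Q * f* - S)`. The
    -- total `7η * Q * f*` is within `ε * (S + Q * f*)`.
    have hf : wmin * G.value y ≤ wmin * ∑ e, y e :=
      mul_le_mul_of_nonneg_left hy.1.value_le_sum hwmin.le
    have hQf : 0 ≤ Q * G.value y := mul_nonneg hQ0.le hy0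
    have hS0 : 0 ≤ ∑ e, q e * y e := (mul_nonneg hwmin.le hy0).trans (hf.trans hS)
    have h1 := mul_le_mul_of_nonneg_left hopt (by positivity : 0 ≤ 6 * tol)
    have h2 := mul_le_mul_of_nonneg_left hS (by positivity : 0 ≤ 2 * tol)
    have h3 := mul_le_mul_of_nonneg_left (hf.trans hS) (by positivity : 0 ≤ 4 * tol)
    have h4 := mul_le_mul_of_nonneg_right (by linarith : 8 * tol ≤ ε)
      (add_nonneg hS0 hQf)
    have h5 := mul_nonneg hη.le hQf
    have h6 := mul_nonneg hη.le hS0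
    linarith
  · have hD : (minCostInput G q Q wmin wmax tol).net.depth = 0 :=
      FlowNetwork.level_eq_zero hsink
    refine ⟨ScalingInput.halts_init_of_depth_eq_zero hD, fun x f hx => ?_⟩
    have h0 := ScalingInput.eq_zero_of_returns_of_depth_eq_zero hD hx
    obtain rfl : x = fun _ => 0 := funext fun e => congrFun h0 (some e)
    obtain rfl : f = 0 := congrFun h0 none
    refine ⟨FlowNetwork.isFlow_zero fun e => (hcap e).1, FlowNetwork.value_zero G, ?_⟩
    rintro y _ hy rfl
    have hy0 : G.value y = 0 := le_antisymm (value_nonpos_of_not_path hst hsink hy.1)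
      (value_nonneg_of_isMinCostFlow (fun e => (hcap e).1) hq0 hQ0 hy)
    have hS : 0 ≤ ∑ e, q e * y e :=
      Finset.sum_nonneg fun e _ => mul_nonneg (hq0 e) (hy.1.nonneg e)
    have : 0 ≤ (1 + ε) * ∑ e, q e * y e := mul_nonneg (by linarith) hS
    simpa [hy0] using this
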